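/- For $N\in\mathbb N$ and $S\subset[N]:=\{1,\dots,N\}$ let $\chi_S(x)=\prod_{k\in S}x_k$, $x\in\{-1,+1\}^N$, and for $f:\{-1,+1\}^N\to\mathbb R$ let $\widehat f(S)=2^{-N}\sum_{x\in\{-1,+1\}^N} f(x)\chi_S(x)$. For a family $\mathcal S$ of subsets of $[N]$ let $\mathcal B^N_{\mathcal S}$ be the real Banach space of all $f:\{-1,+1\}^N\to\mathbb R$ such that $\widehat f(S)\neq0$ only if $S\in\mathcal S$, with the supremum norm. For a real Banach space $X$ let $\boldsymbol\lambda(X)=\sup\boldsymbol\lambda(I(X),Z)$ be its projection constant, where the supremum is over all real Banach spaces $Z$ and all linear isometric embeddings $I:X\to Z$, and $\boldsymbol\lambda(Y,Z)=\inf\{\|P\| : P:Z\to Y \text{ bounded linear},\ P|_{Y}=\mathrm{id}_Y\}$ for a subspace $Y$ of $Z$. For $n\in\mathbb N_0$ let $h_n(t)=(-1)^n e^{t^2/2}\frac{d^n}{dt^n}e^{-t^2/2}$ be the $n$-th probabilist's Hermite polynomial. Then for every integer $d\ge1$, both for the families $\mathcal S=\{S\subset[N]:\operatorname{card}(S)=d\}$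 and for the families $\mathcal S=\{S\subset[N]:\operatorname{card}(S)\le d\}$, the projection constants $\boldsymbol\lambda(\mathcal B^N_{\mathcal S})$ are finite and $$\lim_{N\to\infty}\frac{\boldsymbol\lambda(\mathcal B^N_{\mathcal S})}{\sqrt{\dim \mathcal B^N_{\mathcal S}}}=\frac1{\sqrt{2\pi}}\int_{-\infty}^{\infty}\frac{|h_d(t)|}{\sqrt{d!}}\,e^{-t^2/2}\,dt ,$$ where the integral is finite. Moreover, as $d\to\infty$, $$\frac1{\sqrt{2\pi}}\int_{-\infty}^{\infty}\frac{|h_d(t)|}{\sqrt{d!}}\,e^{-t^2/2}\,dt=\frac{2^{7/4}}{\pi^{5/4}}\,\frac1{d^{1/4}}\Big(1+O\Big(\frac1{d^2}\Big)\Big).$$ -/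

import Mathlib

open Filter Topology MeasureTheory Asymptotics

/-- The `N`-dimensional Boolean cube `{-1, +1}^N` (`ℤˣ = {1, -1}`). -/
abbrev BooleanCube (N : ℕ) : Type := Fin N → ℤˣ

/-- The Walsh function `χ_S(x) = x^S = ∏_{k ∈ S} x_k`. -/
def walsh {N : ℕ} (S : Finset (Fin N)) (x : BooleanCube N) : ℝ :=
  ∏ k ∈ S, ((x k : ℤ) : ℝ)

/-- The Fourier coefficient `𝔼[f χ_S]` with respect to the normalized counting measure. -/
noncomputable def fourierCoefficient {N : ℕ} (f : BooleanCube N → ℝ) (S : Finset (Fin N)) : ℝ :=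
  (1 / (2 : ℝ) ^ N) * ∑ x : BooleanCube N, f x * walsh S x

/-- The space of all real functions on the `N`-dimensional Boolean cube whose Fourier–Walsh
expansion is supported on `𝒮`. Its norm, inherited from the (finite) product
`BooleanCube N → ℝ`, is the supremum norm. -/
noncomputable def BooleanSpace (N : ℕ) (𝒮 : Set (Finset (Fin N))) :
    Submodule ℝ (BooleanCube N → ℝ) where
  carrier := {f | ∀ S, fourierCoefficient f S ≠ 0 → S ∈ 𝒮}
  zero_mem' := by
    intro S h
    exact absurd (by simp [fourierCoefficient]) h
  add_mem' := by
    intro f g hf hg S h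
    by_contra hS
    have h1 : fourierCoefficient f S = 0 := by
      by_contra h'
      exact hS (hf S h')
    have h2 : fourierCoefficient g S = 0 := by
      by_contra h'
      exact hS (hg S h')
    apply h
    have : fourierCoefficient (f + g) S = fourierCoefficient f S + fourierCoefficient g S := by
      simp [fourierCoefficient, add_mul, Finset.sum_add_distrib, mul_add]
    rw [this, h1, h2, add_zero]
  smul_mem' := by
    intro c f hf S h
    by_contra hS
    have h1 : fourierCoefficient f S = 0 := by
      by_contra h'
      exact hS (hf S h')
    apply h
    have : fourierCoefficient (c • f) S = c * fourierCoefficient f S := by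
      simp only [fourierCoefficient, Pi.smul_apply, smul_eq_mul, Finset.mul_sum]
      exact Finset.sum_congr rfl fun x _ => by ring
    rw [this, h1, mul_zero]

/-- The relative projection constant of a subspace `X` of `Y`: the infimum of the norms of all
bounded linear projections of `Y` onto `X` (it is `⊤` if there are none). -/
noncomputable def relativeProjectionConstant {Y : Type*} [NormedAddCommGroup Y] [NormedSpace ℝ Y]
    (X : Submodule ℝ Y) : ENNReal :=
  ⨅ (P : Y →L[ℝ] X) (_ : ∀ x : X, P (x : Y) = x), ENNReal.ofReal ‖P‖

/-- The (absolute) projection constant of a real Banach space `X`: the supremum of the relative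
projection constants of `I(X)` in `Z` over all Banach spaces `Z` and all isometric linear
embeddings `I : X → Z`. (Letting `Z` range over the universe of `X` is no restriction: the
supremum is attained at the canonical embedding of `X` in the bounded functions on the dual unit
ball.) -/
noncomputable def projectionConstant.{u} (X : Type u) [NormedAddCommGroup X] [NormedSpace ℝ X] :
    ENNReal :=
  ⨆ (Z : Type u) (_ : NormedAddCommGroup Z) (_ : NormedSpace ℝ Z) (_ : CompleteSpace Z)
    (I : X →ₗᵢ[ℝ] Z), relativeProjectionConstant (LinearMap.range I.toLinearMap)

/-- The integrand `|h_d(t)| / √(d!) · e^{-t²/2}`; `Polynomial.hermite d` is the probabilist's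
Hermite polynomial `h_d(t) = (-1)^d e^{t²/2} (d/dt)^d e^{-t²/2}`. -/
noncomputable def hermiteIntegrand (d : ℕ) (t : ℝ) : ℝ :=
  |Polynomial.aeval t (Polynomial.hermite d)| / √(d.factorial : ℝ) * Real.exp (-t ^ 2 / 2)

/-- `(2π)^{-1/2} ∫ |h_d(t)| / √(d!) · e^{-t²/2} dt`. -/
noncomputable def hermiteIntegral (d : ℕ) : ℝ :=
  1 / √(2 * Real.pi) * ∫ t : ℝ, hermiteIntegrand d t

/-! ### Orthogonality and completeness of the Walsh functions. -/

section WalshFunctions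

variable {N : ℕ}

/-! The cube is a finite abelian group and the spaces are translation invariant, so their projection
constant is the norm of the orthogonal projection, that is, the normalized `L¹`-norm of the kernel
`D = ∑ χ_S` over `S` in the family (`projectionConstant_booleanSpace`). Hahn–Banach extension of the
point evaluations followed by convolution with `D` gives the upper bound; testing an arbitrary
projection on translates of `sign D` and averaging gives the lower one.

For sets of size `d`, `D` is the `d`-th elementary symmetric polynomial of the signs. Its three-term
recurrence makes it `N^(d/2)/d!` times a polynomial in the normalized sum of the signs, with
parameter `q = 1/N`, which becomes `h_d` at `q = 0` (`walshKernel_powersetCard`). The central limit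
theorem with uniform moment bounds gives `𝔼|D| ~ N^(d/2) 𝔼|h_d|/d!` under the Gaussian law, while
the dimension is `~ N^d/d!`; the quotient tends to `𝔼|h_d|/√d!`. For sizes at most `d`, the lower
levels have smaller order.

For large `d`, `u = h_d e^(-t²/4)/√d!` solves `u'' + (κ² - t²/4)u = 0` with `κ² = d + 1/2`. With `q
= 1/κ²`, an explicit amplitude `A = 1 + O(q)` and a phase with `θ' = κ/A²` give approximate
solutions `A cos θ`, `A sin θ` (`amplitude_equation`); variation of constants bounds the deviation
of `u` by a polynomial in `t` times `κ⁻⁵`, relative to the initial data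
(`exists_abs_sub_oscillation_le`). By parity `|u|` is then close to `c A |cos θ|` or `c A |sin θ|`.
Repeated integration by parts replaces the oscillating factor by its mean `2/π` up to `O(q²)`, so
the integral of `|u| e^(-t²/4)` is `c (4/√π)(1 + q/8)` up to the errors in
`exists_abs_integral_hermiteWave_sub_amplitude_le`.

The constant `c` comes from the values of `h_d` or its derivative at zero, and Wallis' product
determines it to relative precision `O(1/d²)` (`abs_hermiteCentralSq_sub_one_le`). The terms of
relative order `1/d` cancel: passing from `d` to `d + 1/2` is compensated by the factor `1 + q/8`
(`frequency_correction`). -/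

lemma intUnits_coe_mul_self (u : ℤˣ) : ((u : ℤ) : ℝ) * ((u : ℤ) : ℝ) = 1 := by
  rcases Int.units_eq_one_or u with rfl | rfl <;> simp

lemma walsh_mul (S : Finset (Fin N)) (x y : BooleanCube N) :
    walsh S (x * y) = walsh S x * walsh S y := by
  simp [walsh, Finset.prod_mul_distrib]

lemma sum_cube_prod {R : Type*} [CommSemiring R] (f : Fin N → ℤˣ → R) :
    ∑ x : BooleanCube N, ∏ k, f k (x k) = ∏ k, (f k 1 + f k (-1)) := by
  have h := Finset.prod_univ_sum (fun _ : Fin N => (Finset.univ : Finset ℤˣ)) f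
  rw [Fintype.piFinset_univ] at h
  rw [← h]
  refine Finset.prod_congr rfl fun k _ => ?_
  have : (Finset.univ : Finset ℤˣ) = {1, -1} := rfl
  rw [this, Finset.sum_pair (by decide)]

lemma card_cube : Fintype.card (BooleanCube N) = 2 ^ N := by
  simp [BooleanCube, Fintype.card_pi]

lemma sum_walsh_mul_walsh (S T : Finset (Fin N)) :
    ∑ x : BooleanCube N, walsh S x * walsh T x = if S = T then (2 : ℝ) ^ N else 0 := by
  let w : Fin N → ℤˣ → ℝ := fun k u => (if k ∈ S then ((u : ℤ) : ℝ) else 1) *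
    (if k ∈ T then ((u : ℤ) : ℝ) else 1)
  have key : ∀ x : BooleanCube N, walsh S x * walsh T x = ∏ k, w k (x k) := by
    intro x
    simp only [walsh, w]
    rw [Finset.prod_mul_distrib, Finset.prod_ite_mem, Finset.prod_ite_mem, Finset.univ_inter,
      Finset.univ_inter]
  rw [Finset.sum_congr rfl fun x _ => key x, sum_cube_prod w]
  simp only [w]
  split_ifs with h
  · subst h
    have : ∀ k ∈ (Finset.univ : Finset (Fin N)), ((if k ∈ S then (((1 : ℤˣ) : ℤ) : ℝ) else 1) *
        (if k ∈ S then (((1 : ℤˣ) : ℤ) : ℝ) else 1) +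
        (if k ∈ S then (((-1 : ℤˣ) : ℤ) : ℝ) else 1) *
        (if k ∈ S then (((-1 : ℤˣ) : ℤ) : ℝ) else 1)) = 2 := by
      intro k _
      by_cases hk : k ∈ S <;> norm_num [hk]
    rw [Finset.prod_congr rfl this]
    simp
  · obtain ⟨k, hk⟩ : ∃ k, ¬ (k ∈ S ↔ k ∈ T) := by
      by_contra! hc
      exact h (Finset.ext hc)
    refine Finset.prod_eq_zero (Finset.mem_univ k) ?_
    by_cases h1 : k ∈ S <;> by_cases h2 : k ∈ T <;> simp_all

/-- Summing over all `S` expands the product of `1 + x_k y_k`, whose factors are 2 or 0. -/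
lemma sum_walsh_mul_walsh_right (x y : BooleanCube N) :
    ∑ S : Finset (Fin N), walsh S x * walsh S y = if x = y then (2 : ℝ) ^ N else 0 := by
  have h1 : ∑ S : Finset (Fin N), walsh S x * walsh S y
      = ∏ k : Fin N, (1 + ((x k : ℤ) : ℝ) * ((y k : ℤ) : ℝ)) := by
    rw [Finset.prod_one_add, Finset.powerset_univ]
    simp [walsh, Finset.prod_mul_distrib]
  rw [h1]
  split_ifs with h
  · subst h
    simp_rw [intUnits_coe_mul_self]
    norm_num
  · obtain ⟨k, hk⟩ : ∃ k, x k ≠ y k := by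
      by_contra! hc
      exact h (funext hc)
    refine Finset.prod_eq_zero (Finset.mem_univ k) ?_
    rcases Int.units_eq_one_or (x k) with h1 | h1 <;>
      rcases Int.units_eq_one_or (y k) with h2 | h2 <;> simp_all

lemma eq_sum_fourierCoefficient_mul_walsh (f : BooleanCube N → ℝ) (x : BooleanCube N) :
    f x = ∑ S, fourierCoefficient f S * walsh S x := by
  have h : ∀ S, fourierCoefficient f S * walsh S x
      = ∑ y, (1 / (2 : ℝ) ^ N) * f y * (walsh S y * walsh S x) := by
    intro S
    rw [fourierCoefficient, Finset.mul_sum, Finset.sum_mul]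
    exact Finset.sum_congr rfl fun y _ => by ring
  simp_rw [h]
  rw [Finset.sum_comm]
  simp_rw [← Finset.mul_sum, sum_walsh_mul_walsh_right]
  simp
  field_simp

lemma fourierCoefficient_sum_walsh (A : Finset (Finset (Fin N))) (c : Finset (Fin N) → ℝ)
    (T : Finset (Fin N)) :
    fourierCoefficient (fun x => ∑ S ∈ A, c S * walsh S x) T = if T ∈ A then c T else 0 := by
  rw [fourierCoefficient]
  simp_rw [Finset.sum_mul, mul_assoc]
  rw [Finset.sum_comm]
  simp_rw [← Finset.mul_sum, sum_walsh_mul_walsh]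
  simp
  field_simp

lemma fourierCoefficient_linear (f g : BooleanCube N → ℝ) (c : ℝ) (S : Finset (Fin N)) :
    fourierCoefficient (f + c • g) S = fourierCoefficient f S + c * fourierCoefficient g S := by
  simp only [fourierCoefficient, Pi.add_apply, Pi.smul_apply, smul_eq_mul, add_mul,
    Finset.sum_add_distrib, mul_add, Finset.mul_sum]
  congr 1
  exact Finset.sum_congr rfl fun _ _ => by ring

lemma fourierCoefficient_smul (c : ℝ) (f : BooleanCube N → ℝ) (S : Finset (Fin N)) :
    fourierCoefficient (c • f) S = c * fourierCoefficient f S := by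
  have h0 : fourierCoefficient (0 : BooleanCube N → ℝ) S = 0 := by simp [fourierCoefficient]
  simpa [h0] using fourierCoefficient_linear 0 f c S

lemma sum_walsh_mem_booleanSpace (A : Finset (Finset (Fin N))) (c : Finset (Fin N) → ℝ) :
    (fun x => ∑ S ∈ A, c S * walsh S x) ∈ BooleanSpace N (A : Set (Finset (Fin N))) := by
  intro T hT
  rw [fourierCoefficient_sum_walsh] at hT
  by_contra h
  exact hT (if_neg h)

lemma fourierCoefficient_eq_zero {A : Set (Finset (Fin N))} {f : BooleanCube N → ℝ}
    (hf : f ∈ BooleanSpace N A) {S : Finset (Fin N)} (hS : S ∉ A) :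
    fourierCoefficient f S = 0 := by
  by_contra h
  exact hS (hf S h)

lemma eq_sum_of_mem_booleanSpace {A : Finset (Finset (Fin N))} {f : BooleanCube N → ℝ}
    (hf : f ∈ BooleanSpace N (A : Set (Finset (Fin N)))) (x : BooleanCube N) :
    f x = ∑ S ∈ A, fourierCoefficient f S * walsh S x := by
  rw [eq_sum_fourierCoefficient_mul_walsh f x]
  symm
  refine Finset.sum_subset (Finset.subset_univ A) fun S _ hS => ?_
  rw [fourierCoefficient_eq_zero hf (by simpa using hS), zero_mul]

theorem finrank_booleanSpace (A : Finset (Finset (Fin N))) :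
    Module.finrank ℝ (BooleanSpace N (A : Set (Finset (Fin N)))) = A.card := by
  let e : BooleanSpace N (A : Set (Finset (Fin N))) ≃ₗ[ℝ] (A → ℝ) :=
    { toFun := fun f S => fourierCoefficient (f : BooleanCube N → ℝ) S
      map_add' := fun f g => by
        ext S
        simpa using fourierCoefficient_linear (f : BooleanCube N → ℝ) g 1 S
      map_smul' := fun c f => by
        ext S
        simpa using fourierCoefficient_smul c (f : BooleanCube N → ℝ) S
      invFun := fun c => ⟨_, sum_walsh_mem_booleanSpace A
        (fun S => if h : S ∈ A then c ⟨S, h⟩ else 0)⟩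
      left_inv := fun f => by
        ext x
        rw [eq_sum_of_mem_booleanSpace f.2 x]
        refine Finset.sum_congr rfl fun S hS => ?_
        simp [hS]
      right_inv := fun c => by
        ext S
        simp only
        rw [fourierCoefficient_sum_walsh]
        simp }
  rw [e.finrank_eq]
  simp

end WalshFunctions

/-! ### The projection constant as the mean modulus of the kernel. -/

section ProjectionConstant

variable {N : ℕ}

/-- The kernel `∑_{S ∈ A} χ_S` of the orthogonal projection onto the span of `χ_S`, `S ∈ A`. -/
noncomputable def walshKernel (A : Finset (Finset (Fin N))) (x : BooleanCube N) : ℝ :=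
  ∑ S ∈ A, walsh S x

/-- The normalized `L¹`-norm on the Boolean cube. -/
noncomputable def cubeMeanAbs (f : BooleanCube N → ℝ) : ℝ :=
  (1 / (2 : ℝ) ^ N) * ∑ x : BooleanCube N, |f x|

lemma cubeMeanAbs_nonneg (f : BooleanCube N → ℝ) : 0 ≤ cubeMeanAbs f := by
  unfold cubeMeanAbs
  positivity

lemma sum_fourierCoefficient_mul_walsh (A : Finset (Finset (Fin N))) (f : BooleanCube N → ℝ)
    (x : BooleanCube N) :
    ∑ S ∈ A, fourierCoefficient f S * walsh S x
      = (1 / (2 : ℝ) ^ N) * ∑ y, f y * walshKernel A (x * y) := by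
  simp_rw [walshKernel, fourierCoefficient, Finset.mul_sum, Finset.sum_mul]
  rw [Finset.sum_comm]
  refine Finset.sum_congr rfl fun y _ => Finset.sum_congr rfl fun S _ => ?_
  rw [walsh_mul]
  ring

/-- The orthogonal projection is convolution with the kernel, and translation by `x` preserves the
kernel's `L¹`-norm. -/
lemma abs_sum_fourierCoefficient_mul_walsh_le (A : Finset (Finset (Fin N)))
    (f : BooleanCube N → ℝ) {M : ℝ} (hf : ∀ y, |f y| ≤ M) (x : BooleanCube N) :
    |∑ S ∈ A, fourierCoefficient f S * walsh S x| ≤ cubeMeanAbs (walshKernel A) * M := by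
  rw [sum_fourierCoefficient_mul_walsh, abs_mul, abs_of_nonneg (by positivity), cubeMeanAbs,
    mul_assoc]
  gcongr
  calc |∑ y, f y * walshKernel A (x * y)| ≤ ∑ y, |f y * walshKernel A (x * y)| :=
        Finset.abs_sum_le_sum_abs _ _
    _ ≤ ∑ y, |walshKernel A (x * y)| * M := by
        refine Finset.sum_le_sum fun y _ => ?_
        rw [abs_mul, mul_comm]
        gcongr
        exact hf y
    _ = (∑ y, |walshKernel A y|) * M := by
        rw [← Finset.sum_mul]
        congr 1
        exact Fintype.sum_equiv (Equiv.mulLeft x) _ _ fun y => rfl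

/-- The orthogonal projection extends to any superspace without increase of the bound: only the
point evaluations on the cube have to be extended, and Hahn–Banach does this with norm at most 1. -/
theorem relativeProjectionConstant_range_le (A : Finset (Finset (Fin N))) {Z : Type*}
    [NormedAddCommGroup Z] [NormedSpace ℝ Z]
    (I : BooleanSpace N (A : Set (Finset (Fin N))) →ₗᵢ[ℝ] Z) :
    relativeProjectionConstant (LinearMap.range I.toLinearMap)
      ≤ ENNReal.ofReal (cubeMeanAbs (walshKernel A)) := by
  let X := BooleanSpace N (A : Set (Finset (Fin N)))
  have hext : ∀ x : BooleanCube N, ∃ g : Z →L[ℝ] ℝ, (∀ f : X, g (I f) = (f : BooleanCube N → ℝ) x) ∧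
      ‖g‖ ≤ 1 := by
    intro x
    let φ : X →L[ℝ] ℝ := (ContinuousLinearMap.proj (R := ℝ) (φ := fun _ : BooleanCube N => ℝ) x).comp
      X.subtypeL
    let ψ : LinearMap.range I.toLinearMap →L[ℝ] ℝ :=
      φ.comp (I.equivRange.symm.toContinuousLinearEquiv : LinearMap.range I.toLinearMap →L[ℝ] X)
    obtain ⟨g, hg, hgn⟩ := exists_extension_norm_eq (𝕜 := ℝ) (LinearMap.range I.toLinearMap) ψ
    refine ⟨g, fun f => ?_, ?_⟩
    · have := hg (I.equivRange f)
      have h2 : ψ (I.equivRange f) = (f : BooleanCube N → ℝ) x := by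
        simp [ψ, φ]
      rw [h2] at this
      simpa using this
    · rw [hgn]
      refine ContinuousLinearMap.opNorm_le_bound _ zero_le_one fun z => ?_
      have h3 : ‖ψ z‖ ≤ ‖((I.equivRange.symm z : X) : BooleanCube N → ℝ)‖ :=
        norm_le_pi_norm ((I.equivRange.symm z : X) : BooleanCube N → ℝ) x
      rw [one_mul]
      refine h3.trans ?_
      change ‖I.equivRange.symm z‖ ≤ ‖z‖
      rw [LinearIsometryEquiv.norm_map]
  choose g hg hgn using hext
  let P₀ : Z →ₗ[ℝ] X :=
    { toFun := fun z => ⟨_, sum_walsh_mem_booleanSpace A (fourierCoefficient fun x => g x z)⟩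
      map_add' := fun z w => by
        ext x
        have : (fun x => g x (z + w)) = (fun x => g x z) + (1 : ℝ) • (fun x => g x w) := by
          ext; simp
        simp only [this, fourierCoefficient_linear, Submodule.coe_add, Pi.add_apply, one_mul,
          add_mul, Finset.sum_add_distrib]
      map_smul' := fun c z => by
        ext x
        have : (fun x => g x (c • z)) = c • (fun x => g x z) := by
          ext; simp
        simp only [this, fourierCoefficient_smul, mul_assoc, Submodule.coe_smul,
          Pi.smul_apply, smul_eq_mul, Finset.mul_sum, RingHom.id_apply] }
  have hP₀ : ∀ z, ‖P₀ z‖ ≤ cubeMeanAbs (walshKernel A) * ‖z‖ := by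
    intro z
    change ‖(P₀ z : BooleanCube N → ℝ)‖ ≤ _
    refine (pi_norm_le_iff_of_nonneg (mul_nonneg (cubeMeanAbs_nonneg _) (norm_nonneg _))).2 fun x => ?_
    refine abs_sum_fourierCoefficient_mul_walsh_le A _ (fun y => ?_) x
    calc |g y z| ≤ ‖g y‖ * ‖z‖ := (g y).le_opNorm z
      _ ≤ 1 * ‖z‖ := by gcongr; exact hgn y
      _ = ‖z‖ := one_mul _
  let P : Z →L[ℝ] LinearMap.range I.toLinearMap :=
    (I.equivRange.toContinuousLinearEquiv : X →L[ℝ] LinearMap.range I.toLinearMap).comp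
      (P₀.mkContinuous _ hP₀)
  have hPn : ‖P‖ ≤ cubeMeanAbs (walshKernel A) := by
    refine ContinuousLinearMap.opNorm_le_bound _ (cubeMeanAbs_nonneg _) fun z => ?_
    change ‖I.equivRange (P₀ z)‖ ≤ _
    rw [LinearIsometryEquiv.norm_map]
    exact hP₀ z
  have hPid : ∀ x : LinearMap.range I.toLinearMap, P (x : Z) = x := by
    rintro ⟨_, f, rfl⟩
    have h1 : P₀ (I f) = f := by
      ext x
      change ∑ S ∈ A, fourierCoefficient (fun x => g x (I f)) S * walsh S x = _
      simp_rw [hg]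
      exact (eq_sum_of_mem_booleanSpace f.2 x).symm
    change I.equivRange (P₀ (I f)) = _
    rw [h1]
    rfl
  unfold relativeProjectionConstant
  exact iInf₂_le_of_le P hPid (ENNReal.ofReal_le_ofReal hPn)

/-- Averaging over translations turns any projection into the orthogonal one. Here the average is
taken directly on one test function, the sign of the kernel, for which the orthogonal projection
takes the value `𝔼|D|` at the identity. -/
theorem le_relativeProjectionConstant_range_subtype (A : Finset (Finset (Fin N))) :
    ENNReal.ofReal (cubeMeanAbs (walshKernel A)) ≤ relativeProjectionConstant
      (LinearMap.range (BooleanSpace N (A : Set (Finset (Fin N)))).subtypeₗᵢ.toLinearMap) := by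
  set X := BooleanSpace N (A : Set (Finset (Fin N)))
  refine le_iInf₂ fun P hP => ENNReal.ofReal_le_ofReal ?_
  set D := walshKernel A
  let g : BooleanCube N → ℝ := fun x => (SignType.sign (D x) : ℝ)
  have hmem : ∀ f, (P f : BooleanCube N → ℝ) ∈ X := by
    intro f
    obtain ⟨w, hw⟩ := (P f).2
    rw [← hw]
    exact w.2
  have hfix : ∀ f ∈ X, (P f : BooleanCube N → ℝ) = f := by
    intro f hf
    have := hP ⟨f, ⟨f, hf⟩, rfl⟩
    exact congrArg Subtype.val this
  have hexp : ∀ y : BooleanCube N, (fun x => g (y * x))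
      = ∑ S, (fourierCoefficient g S * walsh S y) • (walsh S : BooleanCube N → ℝ) := by
    intro y
    ext x
    rw [eq_sum_fourierCoefficient_mul_walsh g (y * x)]
    simp [walsh_mul, mul_assoc]
  -- All that matters about `P` is its diagonal in the Walsh basis: it fixes `χ_S` for `S ∈ A`, and
  -- otherwise its image has no `χ_S` component.
  have hdiag : ∀ S, ∑ y, walsh S y * (P (walsh S) : BooleanCube N → ℝ) y
      = if S ∈ A then (2 : ℝ) ^ N else 0 := by
    intro S
    split_ifs with hS
    · have hw : walsh S ∈ X := by
        have := sum_walsh_mem_booleanSpace A (fun T => if T = S then 1 else 0)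
        simpa [hS] using this
      rw [hfix _ hw]
      simpa using sum_walsh_mul_walsh S S
    · have := fourierCoefficient_eq_zero (hmem (walsh S)) (S := S) (by simpa using hS)
      rw [fourierCoefficient] at this
      have h2 : ∑ y, (P (walsh S) : BooleanCube N → ℝ) y * walsh S y = 0 := by
        rcases mul_eq_zero.1 this with h | h
        · exact absurd h (by positivity)
        · exact h
      rw [← h2]
      exact Finset.sum_congr rfl fun y _ => mul_comm _ _
  -- Translating by `y` multiplies the `S`-th coefficient of `g` by `χ_S(y)`; summation over `y`
  -- keeps only the diagonal, leaving `2^N ∑_{S ∈ A} ĝ(S) = ∑ g D`.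
  have htrace : ∑ y, (P (fun x => g (y * x)) : BooleanCube N → ℝ) y = ∑ x, |D x| := by
    have h1 : ∀ y, (P (fun x => g (y * x)) : BooleanCube N → ℝ) y
        = ∑ S, fourierCoefficient g S * (walsh S y * (P (walsh S) : BooleanCube N → ℝ) y) := by
      intro y
      let L : (BooleanCube N → ℝ) →ₗ[ℝ] ℝ :=
        (LinearMap.proj y).comp ((Submodule.subtype _).comp P.toLinearMap)
      change L _ = ∑ S, fourierCoefficient g S * (walsh S y * L (walsh S))
      rw [hexp y, map_sum]
      simp only [map_smul, smul_eq_mul, mul_assoc]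
    simp_rw [h1]
    rw [Finset.sum_comm]
    simp_rw [← Finset.mul_sum, hdiag]
    have h2 : ∀ x, |D x| = ∑ S ∈ A, g x * walsh S x := by
      intro x
      rw [← Finset.mul_sum]
      exact (sign_mul_self (D x)).symm
    simp_rw [h2]
    rw [Finset.sum_comm]
    simp only [mul_ite, mul_zero, Finset.sum_ite_mem, Finset.univ_inter]
    refine Finset.sum_congr rfl fun S _ => ?_
    rw [fourierCoefficient]
    field_simp
  have hle : ∀ y, (P (fun x => g (y * x)) : BooleanCube N → ℝ) y ≤ ‖P‖ := by
    intro y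
    have hg1 : ‖(fun x => g (y * x))‖ ≤ 1 := by
      refine (pi_norm_le_iff_of_nonneg zero_le_one).2 fun x => ?_
      simp only [g]
      rcases lt_trichotomy (D (y * x)) 0 with h | h | h <;> simp [h]
    calc (P (fun x => g (y * x)) : BooleanCube N → ℝ) y
        ≤ ‖(P (fun x => g (y * x)) : BooleanCube N → ℝ) y‖ := le_abs_self _
      _ ≤ ‖(P (fun x => g (y * x)) : BooleanCube N → ℝ)‖ := norm_le_pi_norm _ y
      _ = ‖P (fun x => g (y * x))‖ := rfl
      _ ≤ ‖P‖ * ‖(fun x => g (y * x))‖ := P.le_opNorm _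
      _ ≤ ‖P‖ * 1 := by gcongr
      _ = ‖P‖ := mul_one _
  calc cubeMeanAbs D = (1 / (2 : ℝ) ^ N) * ∑ y, (P (fun x => g (y * x)) : BooleanCube N → ℝ) y := by
        rw [htrace, cubeMeanAbs]
    _ ≤ (1 / (2 : ℝ) ^ N) * ∑ _y : BooleanCube N, ‖P‖ := by
        gcongr with y
        exact hle y
    _ = ‖P‖ := by
        rw [Finset.sum_const, Finset.card_univ, card_cube]
        simp

theorem projectionConstant_booleanSpace (A : Finset (Finset (Fin N))) :
    projectionConstant (BooleanSpace N (A : Set (Finset (Fin N))))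
      = ENNReal.ofReal (cubeMeanAbs (walshKernel A)) := by
  refine le_antisymm ?_ ?_
  · refine iSup_le fun Z => iSup_le fun _ => iSup_le fun _ => iSup_le fun _ => iSup_le fun I => ?_
    exact relativeProjectionConstant_range_le A I
  · refine (le_relativeProjectionConstant_range_subtype A).trans ?_
    unfold projectionConstant
    exact le_iSup_of_le (BooleanCube N → ℝ) <| le_iSup_of_le inferInstance <|
      le_iSup_of_le inferInstance <| le_iSup_of_le inferInstance <|
      le_iSup_of_le (BooleanSpace N (A : Set (Finset (Fin N)))).subtypeₗᵢ le_rfl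

end ProjectionConstant

/-! ### Polynomials in a parameter `q` and a variable `t`. -/

section BivariatePolynomials

open Polynomial
open scoped Polynomial.Bivariate

lemma evalEval_eq_eval_map (P : ℝ[X][Y]) (q t : ℝ) :
    P.evalEval q t = (P.map (evalRingHom q)).eval t := by
  rw [map_evalRingHom_eval]

/-- The outer variable is `t` and the coefficients are polynomials in `q`, so `derivative` is the
partial derivative in `t`. -/
lemma hasDerivAt_evalEval (P : ℝ[X][Y]) (q t : ℝ) :
    HasDerivAt (fun t => P.evalEval q t) ((derivative P).evalEval q t) t := by
  simp_rw [evalEval_eq_eval_map, ← derivative_map]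
  exact Polynomial.hasDerivAt _ t

lemma continuous_evalEval (P : ℝ[X][Y]) (q : ℝ) : Continuous fun t => P.evalEval q t :=
  continuous_iff_continuousAt.2 fun t => (hasDerivAt_evalEval P q t).continuousAt

lemma abs_pow_le_one_add_sq_pow (t : ℝ) (n : ℕ) : |t| ^ n ≤ (1 + t ^ 2) ^ n := by
  refine pow_le_pow_left₀ (abs_nonneg t) ?_ n
  nlinarith [sq_nonneg (|t| - 1), sq_abs t, abs_nonneg t]

lemma one_add_sq_pow_mono (t : ℝ) {m n : ℕ} (h : m ≤ n) : (1 + t ^ 2) ^ m ≤ (1 + t ^ 2) ^ n :=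
  pow_le_pow_right₀ (by nlinarith [sq_nonneg t]) h

/-- A polynomial in `(q, t)` is bounded by a power of `1 + t²`, uniformly in `q ∈ [0, 1]`. -/
theorem exists_abs_evalEval_le (P : ℝ[X][Y]) :
    ∃ C : ℝ, 0 ≤ C ∧ ∃ K : ℕ, ∀ q ∈ Set.Icc (0 : ℝ) 1, ∀ t : ℝ,
      |P.evalEval q t| ≤ C * (1 + t ^ 2) ^ K := by
  induction P using Polynomial.induction_on' with
  | add P Q hP hQ =>
    obtain ⟨C, hC, K, h⟩ := hP
    obtain ⟨C', hC', K', h'⟩ := hQ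
    refine ⟨C + C', add_nonneg hC hC', max K K', fun q hq t => ?_⟩
    rw [evalEval_add, add_mul]
    refine (abs_add_le _ _).trans (add_le_add ((h q hq t).trans ?_) ((h' q hq t).trans ?_))
    · exact mul_le_mul_of_nonneg_left (one_add_sq_pow_mono t (le_max_left _ _)) hC
    · exact mul_le_mul_of_nonneg_left (one_add_sq_pow_mono t (le_max_right _ _)) hC'
  | monomial n a =>
    obtain ⟨C, hC⟩ := (isCompact_Icc (a := (0 : ℝ)) (b := 1)).exists_bound_of_continuousOn
      (f := fun q => a.eval q) a.continuous.continuousOn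
    refine ⟨max C 0, le_max_right _ _, n, fun q hq t => ?_⟩
    have h1 : (monomial n a : ℝ[X][Y]).evalEval q t = a.eval q * t ^ n := by
      simp [evalEval, eval_monomial]
    rw [h1, abs_mul, abs_pow]
    exact mul_le_mul ((hC q hq).trans (le_max_left _ _)) (abs_pow_le_one_add_sq_pow t n)
      (by positivity) (le_max_right _ _)

/-- The difference `P(q, t) - P(0, t)` is divisible by `q`. -/
theorem exists_evalEval_sub_eq (P : ℝ[X][Y]) :
    ∃ Q : ℝ[X][Y], ∀ q t : ℝ, P.evalEval q t - P.evalEval 0 t = q * Q.evalEval q t := by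
  induction P using Polynomial.induction_on' with
  | add P Q hP hQ =>
    obtain ⟨P', hP'⟩ := hP
    obtain ⟨Q', hQ'⟩ := hQ
    refine ⟨P' + Q', fun q t => ?_⟩
    rw [evalEval_add, evalEval_add, evalEval_add, mul_add, ← hP', ← hQ']
    ring
  | monomial n a =>
    refine ⟨monomial n a.divX, fun q t => ?_⟩
    have h1 : ∀ (b : ℝ[X]) (r : ℝ), (monomial n b : ℝ[X][Y]).evalEval r t = b.eval r * t ^ n := by
      simp [evalEval, eval_monomial]
    have h2 := congrArg (Polynomial.eval q) (divX_mul_X_add a)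
    have h3 := congrArg (Polynomial.eval 0) (divX_mul_X_add a)
    simp only [eval_add, eval_mul, eval_X, eval_C, mul_zero, zero_add] at h2 h3
    rw [h1, h1, h1, ← h2, ← h3]
    ring

end BivariatePolynomials

/-! ### Hermite polynomials and their deformation with parameter `q`. -/

section Hermite

open Polynomial
open scoped Polynomial.Bivariate

/-- Differentiating `h_{n+2} = X h_{n+1} - h_{n+1}'` and inserting the induction hypothesis, the
last two terms recombine to a multiple of `X h_n - h_n' = h_{n+1}`. -/
theorem derivative_hermite_succ (n : ℕ) :
    derivative (hermite (n + 1)) = ((n : ℤ[X]) + 1) * hermite n := by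
  induction n with
  | zero => simp
  | succ n ih =>
    rw [hermite_succ (n + 1), derivative_sub, derivative_mul, derivative_X, ih, derivative_mul]
    rw [hermite_succ n]
    simp only [derivative_add, derivative_natCast, derivative_one]
    push_cast
    ring

theorem hermite_add_two (n : ℕ) :
    hermite (n + 2) = X * hermite (n + 1) - ((n : ℤ[X]) + 1) * hermite n := by
  rw [hermite_succ (n + 1), derivative_hermite_succ]

/-- The real function of the `n`-th (probabilist's) Hermite polynomial. -/
noncomputable def hermiteFun (n : ℕ) (t : ℝ) : ℝ := aeval t (hermite n)

lemma hermiteFun_zero (t : ℝ) : hermiteFun 0 t = 1 := by simp [hermiteFun]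

lemma hermiteFun_one (t : ℝ) : hermiteFun 1 t = t := by simp [hermiteFun]

lemma hermiteFun_add_two (n : ℕ) (t : ℝ) :
    hermiteFun (n + 2) t = t * hermiteFun (n + 1) t - (n + 1) * hermiteFun n t := by
  simp only [hermiteFun, hermite_add_two, map_sub, map_mul, aeval_X, map_add, map_natCast,
    map_one]

lemma hasDerivAt_hermiteFun_succ (n : ℕ) (t : ℝ) :
    HasDerivAt (hermiteFun (n + 1)) ((n + 1) * hermiteFun n t) t := by
  have h := (hermite (n + 1)).hasDerivAt_aeval t
  rw [derivative_hermite_succ] at h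
  simp only [map_mul, map_add, map_natCast, map_one] at h
  exact h

lemma continuous_hermiteFun (n : ℕ) : Continuous (hermiteFun n) :=
  (hermite n).continuous_aeval

/-- The polynomials in `(q, t)` which for `q = 1 / N` give the normalized elementary symmetric
polynomials on the `N`-dimensional Boolean cube, and for `q = 0` the Hermite polynomials. -/
noncomputable def cubeHermite : ℕ → ℝ[X][Y]
  | 0 => 1
  | 1 => Y
  | n + 2 => Y * cubeHermite (n + 1) - C (C ((n : ℝ) + 1) * (1 - C (n : ℝ) * X)) * cubeHermite n

lemma cubeHermite_evalEval_add_two (n : ℕ) (q t : ℝ) :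
    (cubeHermite (n + 2)).evalEval q t = t * (cubeHermite (n + 1)).evalEval q t
      - (n + 1) * (1 - n * q) * (cubeHermite n).evalEval q t := by
  rw [cubeHermite, evalEval_sub, evalEval_mul, evalEval_mul, evalEval_C, evalEval_X]
  simp

lemma cubeHermite_evalEval_zero : ∀ (n : ℕ) (t : ℝ),
    (cubeHermite n).evalEval 0 t = hermiteFun n t
  | 0, t => by simp [cubeHermite, hermiteFun_zero]
  | 1, t => by simp [cubeHermite, hermiteFun_one]
  | n + 2, t => by
    rw [cubeHermite_evalEval_add_two, hermiteFun_add_two, cubeHermite_evalEval_zero (n + 1),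
      cubeHermite_evalEval_zero n]
    ring

lemma exists_abs_hermiteFun_le (n : ℕ) :
    ∃ C : ℝ, 0 ≤ C ∧ ∃ K : ℕ, ∀ t : ℝ, |hermiteFun n t| ≤ C * (1 + t ^ 2) ^ K := by
  obtain ⟨C, hC, K, h⟩ := exists_abs_evalEval_le (cubeHermite n)
  refine ⟨C, hC, K, fun t => ?_⟩
  rw [← cubeHermite_evalEval_zero]
  exact h 0 (by simp) t

end Hermite

/-! ### Elementary symmetric polynomials of signs. -/

section ElementarySymmetric

variable {ι : Type*} [DecidableEq ι]

lemma sum_powersetCard_succ_insert (f : ι → ℝ) {a : ι} {s : Finset ι} (ha : a ∉ s) (d : ℕ) :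
    ∑ T ∈ (insert a s).powersetCard (d + 1), ∏ i ∈ T, f i
      = ∑ T ∈ s.powersetCard (d + 1), ∏ i ∈ T, f i
        + f a * ∑ T ∈ s.powersetCard d, ∏ i ∈ T, f i := by
  have hmem : ∀ T ∈ s.powersetCard d, a ∉ T := fun T hT h =>
    ha ((Finset.mem_powersetCard.1 hT).1 h)
  rw [Finset.powersetCard_succ_insert ha, Finset.sum_union, Finset.sum_image, Finset.mul_sum]
  · congr 1
    exact Finset.sum_congr rfl fun T hT => Finset.prod_insert (hmem T hT)
  · intro T hT T' hT' h
    rw [← Finset.erase_insert (hmem T hT), h, Finset.erase_insert (hmem T' hT')]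
  · rw [Finset.disjoint_left]
    intro T hT hT'
    obtain ⟨T', _, rfl⟩ := Finset.mem_image.1 hT'
    exact ha ((Finset.mem_powersetCard.1 hT).1 (Finset.mem_insert_self a T'))

/-- The recurrence of the elementary symmetric polynomials of signs. -/
theorem sum_powersetCard_recurrence (f : ι → ℝ) (hf : ∀ i, f i * f i = 1) (s : Finset ι) (d : ℕ) :
    ((d : ℝ) + 2) * ∑ T ∈ s.powersetCard (d + 2), ∏ i ∈ T, f i
      = (∑ i ∈ s, f i) * ∑ T ∈ s.powersetCard (d + 1), ∏ i ∈ T, f i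
        - ((s.card : ℝ) - d) * ∑ T ∈ s.powersetCard d, ∏ i ∈ T, f i := by
  -- Expanding the product of `∑ f i` with the sum over `(d+1)`-sets, an index outside the set
  -- produces each `(d+2)`-set `d + 2` times, and an index inside cancels since `f i * f i = 1`,
  -- producing each `d`-set `card s - d` times. The induction verifies this through `e_k ↦ e_k +
  -- f(a) e_{k-1}` when `a` is adjoined.
  induction s using Finset.induction_on generalizing d with
  | empty =>
    have h : ∀ k, (∅ : Finset ι).powersetCard (k + 1) = ∅ := fun k =>
      Finset.powersetCard_eq_empty.2 (by simp)
    rcases d with _ | d <;> simp [h]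
  | insert a s ha ih =>
    rw [sum_powersetCard_succ_insert f ha (d + 1), sum_powersetCard_succ_insert f ha d,
      Finset.sum_insert ha, Finset.card_insert_of_notMem ha]
    rcases d with _ | d
    · have h0 := ih 0
      have h1 : ∑ T ∈ s.powersetCard 1, ∏ i ∈ T, f i = ∑ i ∈ s, f i := by
        simp [Finset.powersetCard_one]
      simp only [zero_add, Nat.cast_zero, Finset.powersetCard_zero, Finset.sum_singleton,
        Finset.prod_empty, h1] at h0 ⊢
      push_cast
      linear_combination h0 - hf a
    · rw [sum_powersetCard_succ_insert f ha d]
      have h0 := ih d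
      have h1 := ih (d + 1)
      push_cast at h0 h1 ⊢
      linear_combination h1 + f a * h0 -
        (∑ T ∈ s.powersetCard (d + 1), ∏ i ∈ T, f i) * hf a

end ElementarySymmetric

/-! ### The kernel of level `d` as a function of the normalized coordinate sum. -/

section CubeSum

variable {N : ℕ}

/-- The normalized sum of the coordinates. -/
noncomputable def cubeSum (N : ℕ) (x : BooleanCube N) : ℝ := (√N)⁻¹ * ∑ k, ((x k : ℤ) : ℝ)

/-- After scaling by `√N ^ d / d!`, the coefficient `N - d` of the symmetric recurrence becomes `1 -
d q` with `q = 1/N`, which is the recurrence defining `cubeHermite`. -/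
theorem walshKernel_powersetCard (hN : N ≠ 0) (d : ℕ) (x : BooleanCube N) :
    walshKernel (Finset.powersetCard d Finset.univ) x
      = (√N) ^ d / d.factorial * (cubeHermite d).evalEval (1 / (N : ℝ)) (cubeSum N x) := by
  have hs : √(N : ℝ) * √N = N := Real.mul_self_sqrt (Nat.cast_nonneg N)
  have hN' : (N : ℝ) ≠ 0 := Nat.cast_ne_zero.2 hN
  have hs0 : √(N : ℝ) ≠ 0 := by
    intro h
    rw [h, mul_zero] at hs
    exact hN' hs.symm
  induction d using Nat.strongRec with
  | _ d ih =>
    match d, ih with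
    | 0, _ => simp [walshKernel, cubeHermite, walsh]
    | 1, _ =>
      simp [walshKernel, cubeHermite, walsh, cubeSum, Finset.powersetCard_one]
      field_simp
    | d + 2, ih =>
      have h := sum_powersetCard_recurrence (fun k => ((x k : ℤ) : ℝ))
        (fun k => intUnits_coe_mul_self (x k)) Finset.univ d
      have h1 := ih (d + 1) (by omega)
      have h2 := ih d (by omega)
      have h3 : ∑ k, ((x k : ℤ) : ℝ) = √N * cubeSum N x := by
        rw [cubeSum]
        field_simp
      simp only [walshKernel, walsh] at h1 h2 ⊢
      rw [h1, h2, h3, Finset.card_univ, Fintype.card_fin] at h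
      have h4 : (0 : ℝ) < (d : ℝ) + 2 := by positivity
      rw [← mul_right_inj' h4.ne', h, cubeHermite_evalEval_add_two, Nat.factorial_succ (d + 1),
        Nat.factorial_succ d]
      have h5 : (d.factorial : ℝ) ≠ 0 := by positivity
      have h6 : (d : ℝ) + 1 ≠ 0 := by positivity
      push_cast
      rw [show √(N : ℝ) ^ (d + 2) = √(N : ℝ) ^ d * N by rw [pow_add, pow_two, hs],
        show √(N : ℝ) ^ (d + 1) = √(N : ℝ) ^ d * √N by rw [pow_succ]]
      have h7 : ((d : ℝ) + 1 + 1) ≠ 0 := by positivity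
      generalize (cubeHermite (d + 1)).evalEval (1 / (N : ℝ)) (cubeSum N x) = a
      generalize (cubeHermite d).evalEval (1 / (N : ℝ)) (cubeSum N x) = b
      field_simp
      linear_combination (cubeSum N x * a * (d + 2)) * hs

end CubeSum

/-! ### Integrability of polynomial growth against Gaussians. -/

section GaussianWeights

/-- One term of the exponential series of `b(1 + t²)` is bounded by the whole. -/
lemma one_add_sq_pow_le_exp {b : ℝ} (hb : 0 < b) (K : ℕ) (t : ℝ) :
    (1 + t ^ 2) ^ K ≤ K.factorial * b⁻¹ ^ K * Real.exp b * Real.exp (b * t ^ 2) := by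
  have h := Real.pow_div_factorial_le_exp (b * (1 + t ^ 2)) (by positivity) K
  rw [div_le_iff₀ (by positivity)] at h
  calc (1 + t ^ 2) ^ K = b⁻¹ ^ K * (b * (1 + t ^ 2)) ^ K := by
        rw [← mul_pow]
        congr 1
        field_simp
    _ ≤ b⁻¹ ^ K * (Real.exp (b * (1 + t ^ 2)) * K.factorial) := by gcongr
    _ = _ := by
        rw [mul_add, mul_one, Real.exp_add]
        ring

lemma integrable_one_add_sq_pow_mul_exp {b : ℝ} (hb : 0 < b) (K : ℕ) :
    Integrable fun t : ℝ => (1 + t ^ 2) ^ K * Real.exp (-b * t ^ 2) := by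
  -- Half of the Gaussian decay absorbs the polynomial.
  have hi := (integrable_exp_neg_mul_sq (half_pos hb)).const_mul
    (K.factorial * (b / 2)⁻¹ ^ K * Real.exp (b / 2))
  refine hi.mono' (by fun_prop) (ae_of_all _ fun t => ?_)
  rw [Real.norm_eq_abs, abs_of_nonneg (by positivity)]
  calc (1 + t ^ 2) ^ K * Real.exp (-b * t ^ 2)
      ≤ K.factorial * (b / 2)⁻¹ ^ K * Real.exp (b / 2) * Real.exp (b / 2 * t ^ 2)
        * Real.exp (-b * t ^ 2) := by
        gcongr
        exact one_add_sq_pow_le_exp (half_pos hb) K t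
    _ = _ := by
        rw [mul_assoc, ← Real.exp_add]
        congr 2
        ring

/-- Continuous functions of polynomial growth are integrable against Gaussian weights. -/
lemma integrable_mul_exp_of_le {b : ℝ} (hb : 0 < b) {f : ℝ → ℝ} (hf : Continuous f) {C : ℝ} {K : ℕ}
    (h : ∀ t, |f t| ≤ C * (1 + t ^ 2) ^ K) :
    Integrable fun t : ℝ => f t * Real.exp (-b * t ^ 2) := by
  refine ((integrable_one_add_sq_pow_mul_exp hb K).const_mul C).mono' (by fun_prop)
    (ae_of_all _ fun t => ?_)
  rw [Real.norm_eq_abs, abs_mul, abs_of_pos (Real.exp_pos _), ← mul_assoc]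
  gcongr
  exact h t

end GaussianWeights

/-! ### The central limit theorem for functions of polynomial growth. -/

section CentralLimit

open ProbabilityTheory

/-- The mean value of a function on the Boolean cube. -/
noncomputable def cubeMean {N : ℕ} (f : BooleanCube N → ℝ) : ℝ :=
  (1 / (2 : ℝ) ^ N) * ∑ x : BooleanCube N, f x

/-- The law of the normalized sum of the coordinates on the Boolean cube. -/
noncomputable def cubeSumLaw (N : ℕ) : Measure ℝ :=
  ∑ x : BooleanCube N, ENNReal.ofReal (1 / (2 : ℝ) ^ N) • Measure.dirac (cubeSum N x)

lemma integrable_cubeSumLaw {E : Type*} [NormedAddCommGroup E] (N : ℕ)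
    (f : ℝ → E) : Integrable f (cubeSumLaw N) := by
  rw [cubeSumLaw, integrable_finsetSum_measure]
  intro x _
  exact (integrable_dirac (by simp)).smul_measure (by simp)

lemma integral_cubeSumLaw {E : Type*} [NormedAddCommGroup E] [NormedSpace ℝ E] [CompleteSpace E]
    (N : ℕ) (f : ℝ → E) :
    ∫ t, f t ∂(cubeSumLaw N) = (1 / (2 : ℝ) ^ N) • ∑ x : BooleanCube N, f (cubeSum N x) := by
  rw [cubeSumLaw, integral_finsetSum_measure, Finset.smul_sum]
  · refine Finset.sum_congr rfl fun x _ => ?_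
    rw [integral_smul_measure, integral_dirac, ENNReal.toReal_ofReal (by positivity)]
  · intro x _
    exact (integrable_dirac (by simp)).smul_measure (by simp)

instance (N : ℕ) : IsProbabilityMeasure (cubeSumLaw N) := by
  constructor
  rw [cubeSumLaw, Measure.finsetSum_apply]
  simp only [Measure.smul_apply, measure_univ, smul_eq_mul, mul_one, Finset.sum_const,
    Finset.card_univ, card_cube, nsmul_eq_mul]
  rw [one_div, ENNReal.ofReal_inv_of_pos (by positivity), ENNReal.ofReal_pow (by norm_num)]
  push_cast
  rw [ENNReal.ofReal_ofNat]
  exact ENNReal.mul_inv_cancel (by simp) (by simp)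

lemma charFun_cubeSumLaw (N : ℕ) (ξ : ℝ) :
    charFun (cubeSumLaw N) ξ = (Real.cos ((√N)⁻¹ * ξ) : ℂ) ^ N := by
  rw [charFun_apply_real, integral_cubeSumLaw]
  let w : Fin N → ℤˣ → ℂ := fun _ u => Complex.exp (((√N)⁻¹ * ξ : ℝ) * (((u : ℤ) : ℝ) : ℂ) * Complex.I)
  have h : ∀ x : BooleanCube N, Complex.exp (ξ * (cubeSum N x) * Complex.I) = ∏ k, w k (x k) := by
    intro x
    simp only [w]
    rw [← Complex.exp_sum, ← Finset.sum_mul, ← Finset.mul_sum, cubeSum]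
    congr 2
    push_cast
    ring
  rw [Finset.sum_congr rfl fun x _ => h x, sum_cube_prod w]
  simp only [w]
  rw [Finset.prod_const, Finset.card_univ, Fintype.card_fin, Complex.ofReal_cos, Complex.cos, div_pow]
  simp only [Units.val_one, Int.cast_one, Complex.ofReal_one, mul_one, Units.val_neg, Int.cast_neg,
    Complex.ofReal_neg, mul_neg, Complex.real_smul]
  push_cast
  ring

/-- `cubeSumLaw` as a bundled probability measure. -/
noncomputable def cubeSumProbabilityLaw (N : ℕ) : ProbabilityMeasure ℝ :=
  ⟨cubeSumLaw N, inferInstance⟩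

/-- The standard Gaussian measure as a bundled probability measure. -/
noncomputable def gaussianProbabilityLaw : ProbabilityMeasure ℝ := ⟨gaussianReal 0 1, inferInstance⟩

/-- By Lévy's theorem characteristic functions suffice. Since the coordinates are independent, that
of `cubeSumLaw N` is the `N`-th power of the rescaled one of `cubeSumLaw 1`, a centred law of
variance 1. -/
theorem tendsto_cubeSumProbabilityLaw :
    Tendsto cubeSumProbabilityLaw atTop (𝓝 gaussianProbabilityLaw) := by
  refine ProbabilityMeasure.tendsto_iff_tendsto_charFun.2 fun ξ => ?_
  have h0 : ∫ t, t ∂(cubeSumLaw 1) = 0 := by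
    rw [integral_cubeSumLaw]
    have := sum_cube_prod (N := 1) (fun _ u => ((u : ℤ) : ℝ))
    simp [cubeSum] at this ⊢
    exact this
  have h1 : ∫ t, t ^ 2 ∂(cubeSumLaw 1) = 1 := by
    rw [integral_cubeSumLaw]
    have : ∀ x : BooleanCube 1, cubeSum 1 x ^ 2 = 1 := fun x => by
      simpa [cubeSum, pow_two] using intUnits_coe_mul_self (x 0)
    simp [this]
  have h := tendsto_charFun_inv_sqrt_mul_pow (P := cubeSumLaw 1) (X := id) aemeasurable_id
    (by simpa using h0) (by simpa using h1) ξ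
  simp only [Measure.map_id, charFun_cubeSumLaw] at h
  simp only [cubeSumProbabilityLaw, gaussianProbabilityLaw, ProbabilityMeasure.coe_mk, charFun_cubeSumLaw, charFun_gaussianReal]
  convert h using 2
  · simp
  · congr 1
    push_cast
    ring

lemma cubeMean_comp_cubeSum (N : ℕ) (f : ℝ → ℝ) :
    cubeMean (fun x => f (cubeSum N x)) = ∫ t, f t ∂(cubeSumLaw N) := by
  rw [integral_cubeSumLaw, cubeMean, smul_eq_mul]

/-- A bound for exponential moments uniform in `N`, from which all polynomial moments are
controlled. It is the subgaussian estimate `cosh x ≤ exp (x² / 2)` applied to each of the `N`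
coordinates with `x = 1/√N`. -/
lemma integral_cosh_cubeSumLaw_le (N : ℕ) :
    ∫ t, Real.cosh t ∂(cubeSumLaw N) ≤ Real.exp (1 / 2) := by
  have key : ∀ c : ℝ, ∑ x : BooleanCube N, Real.exp (c * cubeSum N x)
      = (2 * Real.cosh (c * (√N)⁻¹)) ^ N := by
    intro c
    let w : Fin N → ℤˣ → ℝ := fun _ u => Real.exp (c * (√N)⁻¹ * ((u : ℤ) : ℝ))
    have h : ∀ x : BooleanCube N, Real.exp (c * cubeSum N x) = ∏ k, w k (x k) := by
      intro x
      simp only [w]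
      rw [← Real.exp_sum, ← Finset.mul_sum, cubeSum, mul_assoc]
    rw [Finset.sum_congr rfl fun x _ => h x, sum_cube_prod w]
    simp only [w]
    rw [Finset.prod_const, Finset.card_univ, Fintype.card_fin, Real.cosh_eq]
    congr 1
    simp
    ring
  have h1 := key 1
  have h2 := key (-1)
  rw [integral_cubeSumLaw]
  simp only [Real.cosh_eq, ← Finset.sum_div, Finset.sum_add_distrib, smul_eq_mul]
  simp only [one_mul, neg_mul, Real.cosh_neg] at h1 h2
  rw [h1, h2, mul_pow]
  calc _ = Real.cosh (√N)⁻¹ ^ N := by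
        field_simp
        ring
    _ ≤ Real.exp ((√N)⁻¹ ^ 2 / 2) ^ N := by
        gcongr
        exact Real.cosh_le_exp_half_sq _
    _ = Real.exp (N * ((N : ℝ)⁻¹ / 2)) := by
        rw [← Real.exp_nat_mul, inv_pow, Real.sq_sqrt (Nat.cast_nonneg N)]
    _ ≤ Real.exp (1 / 2) := by
        rw [Real.exp_le_exp]
        rcases Nat.eq_zero_or_pos N with rfl | h
        · simp
        · have : (N : ℝ) ≠ 0 := by positivity
          field_simp
          exact le_refl _

/-- The moments of the normalized coordinate sums are bounded. -/
lemma exists_integral_cubeSumLaw_le (K : ℕ) :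
    ∃ M : ℝ, 0 ≤ M ∧ ∀ N, ∫ t, (1 + t ^ 2) ^ K ∂(cubeSumLaw N) ≤ M := by
  refine ⟨((2 * K).factorial * Real.exp 1 * 2) * Real.exp (1 / 2), by positivity, fun N => ?_⟩
  have hb : ∀ t : ℝ, (1 + t ^ 2) ^ K ≤ ((2 * K).factorial * Real.exp 1 * 2) * Real.cosh t := by
    intro t
    have h1 : 1 + t ^ 2 ≤ (1 + |t|) ^ 2 := by
      nlinarith [abs_nonneg t, sq_abs t]
    have h2 := Real.pow_div_factorial_le_exp (1 + |t|) (by positivity) (2 * K)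
    rw [div_le_iff₀ (by positivity)] at h2
    have h3 : Real.exp |t| ≤ 2 * Real.cosh t := by
      rw [← Real.cosh_abs, Real.cosh_eq]
      have := Real.exp_pos (-|t|)
      linarith
    calc (1 + t ^ 2) ^ K ≤ ((1 + |t|) ^ 2) ^ K := by gcongr
      _ = (1 + |t|) ^ (2 * K) := by rw [pow_mul]
      _ ≤ Real.exp (1 + |t|) * (2 * K).factorial := h2
      _ = (2 * K).factorial * Real.exp 1 * Real.exp |t| := by rw [Real.exp_add]; ring
      _ ≤ (2 * K).factorial * Real.exp 1 * (2 * Real.cosh t) := by gcongr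
      _ = _ := by ring
  calc ∫ t, (1 + t ^ 2) ^ K ∂(cubeSumLaw N)
      ≤ ∫ t, ((2 * K).factorial * Real.exp 1 * 2) * Real.cosh t ∂(cubeSumLaw N) :=
        integral_mono (integrable_cubeSumLaw N _) (integrable_cubeSumLaw N _) hb
    _ = ((2 * K).factorial * Real.exp 1 * 2) * ∫ t, Real.cosh t ∂(cubeSumLaw N) :=
        integral_const_mul _ _
    _ ≤ _ := by
        gcongr
        exact integral_cosh_cubeSumLaw_le N

/-- The truncation error vanishes where `f ≤ R` and is at most `f² / R` elsewhere. -/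
lemma integral_sub_min_le {μ : Measure ℝ} {f : ℝ → ℝ} {R : ℝ} (hR : 0 < R)
    (hfi : Integrable f μ) (hfm : Integrable (fun t => min (f t) R) μ)
    (hf2 : Integrable (fun t => f t ^ 2) μ) :
    |∫ t, f t ∂μ - ∫ t, min (f t) R ∂μ| ≤ R⁻¹ * ∫ t, f t ^ 2 ∂μ := by
  rw [← integral_sub hfi hfm, ← integral_const_mul]
  refine (abs_integral_le_integral_abs).trans ?_
  refine integral_mono (hfi.sub hfm).abs (hf2.const_mul _) fun t => ?_
  rw [inv_mul_eq_div]
  simp only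
  rw [abs_of_nonneg (sub_nonneg.2 (min_le_left _ _))]
  rcases le_total (f t) R with h | h
  · rw [min_eq_left h, sub_self]
    positivity
  · rw [min_eq_right h, le_div_iff₀ hR]
    nlinarith [sq_nonneg (f t - R), sq_nonneg (f t), sq_nonneg R]

/-- Weak convergence only tests bounded functions, so `f` is cut off at height `R`; second moments
bounded uniformly in `N` make the cut-off error uniformly small. -/
theorem tendsto_integral_cubeSumLaw {f : ℝ → ℝ} (hf : Continuous f) (hf0 : ∀ t, 0 ≤ f t)
    {C : ℝ} {K : ℕ} (hfC : ∀ t, f t ≤ C * (1 + t ^ 2) ^ K) :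
    Tendsto (fun N => ∫ t, f t ∂(cubeSumLaw N)) atTop (𝓝 (∫ t, f t ∂(gaussianReal 0 1))) := by
  obtain ⟨M, hM, hMN⟩ := exists_integral_cubeSumLaw_le (2 * K)
  have hsq : ∀ t, f t ^ 2 ≤ C ^ 2 * (1 + t ^ 2) ^ (2 * K) := fun t => by
    calc f t ^ 2 ≤ (C * (1 + t ^ 2) ^ K) ^ 2 := pow_le_pow_left₀ (hf0 t) (hfC t) 2
      _ = _ := by ring
  have hg : ∀ {g : ℝ → ℝ}, Continuous g → (∃ C' : ℝ, ∃ L : ℕ, ∀ t, |g t| ≤ C' * (1 + t ^ 2) ^ L) →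
      Integrable g (gaussianReal 0 1) := by
    rintro g hgc ⟨C', L, hgL⟩
    rw [gaussianReal_of_var_ne_zero 0 one_ne_zero, integrable_withDensity_iff_integrable_smul']
    · have := (integrable_mul_exp_of_le (b := 1 / 2) (by norm_num) hgc hgL).const_mul
        (√(2 * Real.pi))⁻¹
      refine this.congr (ae_of_all _ fun t => ?_)
      simp only [gaussianPDF, gaussianPDFReal, smul_eq_mul]
      rw [ENNReal.toReal_ofReal (by positivity)]
      simp
      ring_nf
    · exact measurable_gaussianPDF _ _
    · exact ae_of_all _ fun _ => gaussianPDF_lt_top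
  set γ := gaussianReal 0 1
  have hfi : Integrable f γ := hg hf ⟨C, K, fun t => by rw [abs_of_nonneg (hf0 t)]; exact hfC t⟩
  have hf2 : Integrable (fun t => f t ^ 2) γ := hg (hf.pow 2)
    ⟨C ^ 2, 2 * K, fun t => by rw [abs_of_nonneg (by positivity)]; exact hsq t⟩
  set M' := ∫ t, f t ^ 2 ∂γ
  have hM' : 0 ≤ M' := integral_nonneg fun t => by positivity
  rw [Metric.tendsto_atTop]
  intro ε hε
  -- Large enough for the truncation errors under the cube laws and under the Gaussian law to be at
  -- most `ε / 3` each.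
  set R := 3 * (C ^ 2 * M + M' + 1) / ε with hRdef
  have hR : 0 < R := by positivity
  have hRε : R⁻¹ * (C ^ 2 * M + M' + 1) = ε / 3 := by
    rw [hRdef]
    field_simp
  let F : BoundedContinuousFunction ℝ ℝ :=
    BoundedContinuousFunction.ofNormedAddCommGroup (fun t => min (f t) R) (by fun_prop) R fun t => by
      rw [Real.norm_eq_abs, abs_of_nonneg (le_min (hf0 t) hR.le)]
      exact min_le_right _ _
  have hmi : Integrable (fun t => min (f t) R) γ := F.integrable γ
  have hF := (ProbabilityMeasure.tendsto_iff_forall_integral_tendsto.1 tendsto_cubeSumProbabilityLaw) F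
  obtain ⟨N₀, hN₀⟩ := Metric.tendsto_atTop.1 hF (ε / 3) (by positivity)
  refine ⟨N₀, fun N hN => ?_⟩
  have h1 := hN₀ N hN
  change |∫ t, min (f t) R ∂(cubeSumLaw N) - ∫ t, min (f t) R ∂γ| < ε / 3 at h1
  have h2 := integral_sub_min_le hR (integrable_cubeSumLaw N f) (integrable_cubeSumLaw N _)
    (integrable_cubeSumLaw N _)
  have h3 := integral_sub_min_le hR hfi hmi hf2
  have h4 : ∫ t, f t ^ 2 ∂(cubeSumLaw N) ≤ C ^ 2 * M := by
    calc ∫ t, f t ^ 2 ∂(cubeSumLaw N) ≤ ∫ t, C ^ 2 * (1 + t ^ 2) ^ (2 * K) ∂(cubeSumLaw N) :=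
          integral_mono (integrable_cubeSumLaw N _) (integrable_cubeSumLaw N _) hsq
      _ = C ^ 2 * ∫ t, (1 + t ^ 2) ^ (2 * K) ∂(cubeSumLaw N) := integral_const_mul _ _
      _ ≤ _ := by gcongr; exact hMN N
  have hRi : 0 < R⁻¹ := inv_pos.2 hR
  have h5 : R⁻¹ * ∫ t, f t ^ 2 ∂(cubeSumLaw N) ≤ ε / 3 := by
    rw [← hRε]
    gcongr
    linarith
  have h6 : R⁻¹ * M' ≤ ε / 3 := by
    rw [← hRε]
    gcongr
    nlinarith [mul_nonneg (sq_nonneg C) hM]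
  rw [Real.dist_eq]
  rw [abs_lt] at h1 ⊢
  have h7 := abs_le.1 (h2.trans h5)
  have h8 := abs_le.1 (h3.trans h6)
  constructor <;> linarith [h7.1, h7.2, h8.1, h8.2]

end CentralLimit

/-! ### Limits of the projection constants divided by the root of the dimension. -/

section CubeLimit

open ProbabilityTheory

lemma integrable_hermiteFun_mul_exp {b : ℝ} (hb : 0 < b) (d : ℕ) :
    Integrable fun t : ℝ => hermiteFun d t * Real.exp (-b * t ^ 2) := by
  obtain ⟨C, -, K, h⟩ := exists_abs_hermiteFun_le d
  exact integrable_mul_exp_of_le hb (continuous_hermiteFun d) h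

theorem integrable_hermiteIntegrand (d : ℕ) : Integrable (hermiteIntegrand d) := by
  have h := ((integrable_hermiteFun_mul_exp (b := 1 / 2) (by norm_num) d).abs).const_mul
    (1 / √(d.factorial : ℝ))
  refine h.congr (ae_of_all _ fun t => ?_)
  simp only [hermiteIntegrand, abs_mul, abs_of_pos (Real.exp_pos _), hermiteFun]
  rw [show -(1 / 2) * t ^ 2 = -t ^ 2 / 2 by ring]
  ring

theorem hermiteIntegral_eq_gaussian (d : ℕ) :
    hermiteIntegral d = (∫ t, |hermiteFun d t| ∂(gaussianReal 0 1)) / √(d.factorial : ℝ) := by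
  rw [integral_gaussianReal_eq_integral_smul one_ne_zero, hermiteIntegral, ← integral_const_mul,
    ← integral_div]
  refine integral_congr_ae (ae_of_all _ fun t => ?_)
  simp only [hermiteIntegrand, gaussianPDFReal, smul_eq_mul, hermiteFun, sub_zero, NNReal.coe_one,
    mul_one]
  ring

/-- Replacing `q = 1/N` by `q = 0` in `cubeHermite` costs `1/N` times a polynomial, whose mean under
the cube laws is bounded; the central limit theorem then applies to `|h_d|`. -/
theorem tendsto_cubeMeanAbs_walshKernel (d : ℕ) :
    Tendsto (fun N : ℕ => cubeMeanAbs
        (walshKernel (Finset.powersetCard d (Finset.univ : Finset (Fin N)))) / √(N : ℝ) ^ d)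
      atTop (𝓝 ((∫ t, |hermiteFun d t| ∂(gaussianReal 0 1)) / d.factorial)) := by
  obtain ⟨C, hC, K, hCK⟩ := exists_abs_hermiteFun_le d
  have hlim := tendsto_integral_cubeSumLaw (continuous_hermiteFun d).abs (fun t => abs_nonneg _) hCK
  obtain ⟨H, hH⟩ := exists_evalEval_sub_eq (cubeHermite d)
  obtain ⟨C', hC', K', hCK'⟩ := exists_abs_evalEval_le H
  obtain ⟨M, hM, hMN⟩ := exists_integral_cubeSumLaw_le K'
  have hdiff : ∀ N : ℕ, N ≠ 0 →
      |∫ t, |(cubeHermite d).evalEval (1 / (N : ℝ)) t| ∂(cubeSumLaw N)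
        - ∫ t, |hermiteFun d t| ∂(cubeSumLaw N)| ≤ C' * M * (1 / (N : ℝ)) := by
    intro N hN
    have hq : (1 / (N : ℝ)) ∈ Set.Icc (0 : ℝ) 1 :=
      ⟨by positivity, by
        rw [div_le_one (by positivity)]
        exact_mod_cast Nat.one_le_iff_ne_zero.2 hN⟩
    rw [← integral_sub (integrable_cubeSumLaw N _) (integrable_cubeSumLaw N _)]
    calc _ ≤ ∫ t, |(|(cubeHermite d).evalEval (1 / (N : ℝ)) t| - |hermiteFun d t|)|
          ∂(cubeSumLaw N) := abs_integral_le_integral_abs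
      _ ≤ ∫ t, (1 / (N : ℝ)) * C' * (1 + t ^ 2) ^ K' ∂(cubeSumLaw N) := by
          refine integral_mono (integrable_cubeSumLaw N _) (integrable_cubeSumLaw N _) fun t => ?_
          refine (abs_abs_sub_abs_le_abs_sub _ _).trans ?_
          rw [← cubeHermite_evalEval_zero, hH, abs_mul, abs_of_nonneg hq.1, mul_assoc]
          gcongr
          exact hCK' _ hq t
      _ = (1 / (N : ℝ)) * C' * ∫ t, (1 + t ^ 2) ^ K' ∂(cubeSumLaw N) := integral_const_mul _ _
      _ ≤ (1 / (N : ℝ)) * C' * M := by gcongr; exact hMN N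
      _ = _ := by ring
  have hdiff0 : Tendsto (fun N : ℕ => ∫ t, |(cubeHermite d).evalEval (1 / (N : ℝ)) t| ∂(cubeSumLaw N)
        - ∫ t, |hermiteFun d t| ∂(cubeSumLaw N)) atTop (𝓝 0) := by
    refine squeeze_zero_norm' (a := fun N : ℕ => C' * M * (1 / (N : ℝ))) ?_ ?_
    · filter_upwards [eventually_ne_atTop 0] with N hN using hdiff N hN
    · simpa using tendsto_one_div_atTop_nhds_zero_nat.const_mul (C' * M)
  have h := (hdiff0.add hlim).div_const (d.factorial : ℝ)
  rw [zero_add] at h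
  refine h.congr' ?_
  filter_upwards [eventually_ne_atTop 0] with N hN
  have hN' : √(N : ℝ) ≠ 0 := by positivity
  rw [sub_add_cancel, ← cubeMean_comp_cubeSum N (fun t => |(cubeHermite d).evalEval (1 / (N : ℝ)) t|),
    cubeMeanAbs, cubeMean]
  simp_rw [walshKernel_powersetCard hN d, abs_mul]
  rw [← Finset.mul_sum, abs_of_nonneg (by positivity)]
  field_simp

lemma tendsto_choose_div_pow (d : ℕ) :
    Tendsto (fun N : ℕ => (N.choose d : ℝ) / (N : ℝ) ^ d) atTop (𝓝 (1 / d.factorial)) := by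
  have h := (isEquivalent_iff_tendsto_one (by
    filter_upwards [eventually_ne_atTop 0] with N hN
    positivity)).1 (isEquivalent_choose d)
  have h2 := h.div_const (d.factorial : ℝ)
  refine h2.congr fun N => ?_
  simp only [Pi.div_apply]
  have : (d.factorial : ℝ) ≠ 0 := by positivity
  field_simp

lemma tendsto_pow_div_pow_of_lt {k d : ℕ} (h : k < d) :
    Tendsto (fun N : ℕ => (√(N : ℝ)) ^ k / (√(N : ℝ)) ^ d) atTop (𝓝 0) := by
  have hs : Tendsto (fun N : ℕ => √(N : ℝ)) atTop atTop :=
    Real.tendsto_sqrt_atTop.comp tendsto_natCast_atTop_atTop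
  have h1 := (tendsto_inv_atTop_zero.comp hs).pow (d - k)
  rw [zero_pow (by omega)] at h1
  refine h1.congr' ?_
  filter_upwards [eventually_ne_atTop 0] with N hN
  have hN' : √(N : ℝ) ≠ 0 := by positivity
  rw [eq_div_iff (by positivity), ← pow_sub_mul_pow _ h.le]
  simp only [Function.comp, inv_pow]
  field_simp

/-- The sets of cardinality at most `d`. -/
def smallSubsets (N d : ℕ) : Finset (Finset (Fin N)) := Finset.univ.filter fun S => S.card ≤ d

lemma smallSubsets_succ (N d : ℕ) :
    smallSubsets N (d + 1)
      = (smallSubsets N d).disjUnion (Finset.powersetCard (d + 1) Finset.univ) (by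
          rw [Finset.disjoint_left]
          intro S hS hS'
          have h1 := (Finset.mem_filter.1 hS).2
          have h2 := (Finset.mem_powersetCard.1 hS').2
          omega) := by
  ext S
  simp only [smallSubsets, Finset.mem_disjUnion, Finset.mem_filter, Finset.mem_univ, true_and,
    Finset.mem_powersetCard, Finset.subset_univ]
  omega

lemma smallSubsets_zero (N : ℕ) :
    smallSubsets N 0 = Finset.powersetCard 0 Finset.univ := by
  ext S
  simp [smallSubsets]

lemma tendsto_card_smallSubsets (d : ℕ) :
    Tendsto (fun N : ℕ => ((smallSubsets N d).card : ℝ) / (N : ℝ) ^ d) atTop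
      (𝓝 (1 / d.factorial)) := by
  induction d with
  | zero => simp [smallSubsets_zero]
  | succ d ih =>
    have h1 : Tendsto (fun N : ℕ => (N : ℝ)⁻¹) atTop (𝓝 0) :=
      tendsto_inv_atTop_zero.comp tendsto_natCast_atTop_atTop
    have h := (ih.mul h1).add (tendsto_choose_div_pow (d + 1))
    rw [mul_zero, zero_add] at h
    refine h.congr' ?_
    filter_upwards [eventually_ne_atTop 0] with N hN
    have hN' : (N : ℝ) ≠ 0 := by positivity
    rw [smallSubsets_succ, Finset.card_disjUnion, Finset.card_powersetCard, Finset.card_univ,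
      Fintype.card_fin]
    push_cast
    field_simp
    ring

lemma abs_cubeMeanAbs_add_sub_le {N : ℕ} (f g : BooleanCube N → ℝ) :
    |cubeMeanAbs (fun x => f x + g x) - cubeMeanAbs g| ≤ cubeMeanAbs f := by
  rw [cubeMeanAbs, cubeMeanAbs, cubeMeanAbs, ← mul_sub, ← Finset.sum_sub_distrib, abs_mul,
    abs_of_nonneg (by positivity)]
  gcongr
  refine (Finset.abs_sum_le_sum_abs _ _).trans (Finset.sum_le_sum fun x _ => ?_)
  refine (abs_abs_sub_abs_le_abs_sub _ _).trans ?_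
  rw [add_sub_cancel_right]

/-- The top level dominates: by induction the kernel of all lower levels has mean modulus of order
`√N ^ d`, negligible against `√N ^ (d + 1)`. -/
theorem tendsto_cubeMeanAbs_walshKernel_smallSubsets (d : ℕ) :
    Tendsto (fun N : ℕ => cubeMeanAbs (walshKernel (smallSubsets N d)) / √(N : ℝ) ^ d)
      atTop (𝓝 ((∫ t, |hermiteFun d t| ∂(gaussianReal 0 1)) / d.factorial)) := by
  induction d with
  | zero => simpa only [smallSubsets_zero] using tendsto_cubeMeanAbs_walshKernel 0
  | succ d ih =>
    have h0 := ih.mul (tendsto_pow_div_pow_of_lt (Nat.lt_succ_self d))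
    rw [mul_zero] at h0
    have hdiff : Tendsto (fun N : ℕ => cubeMeanAbs (walshKernel (smallSubsets N (d + 1)))
        / √(N : ℝ) ^ (d + 1) - cubeMeanAbs
        (walshKernel (Finset.powersetCard (d + 1) (Finset.univ : Finset (Fin N))))
        / √(N : ℝ) ^ (d + 1)) atTop (𝓝 0) := by
      refine squeeze_zero_norm' ?_ h0
      filter_upwards [eventually_ne_atTop 0] with N hN
      have hN' : √(N : ℝ) ≠ 0 := by positivity
      have hk : walshKernel (smallSubsets N (d + 1)) = fun x => walshKernel (smallSubsets N d) x
          + walshKernel (Finset.powersetCard (d + 1) Finset.univ) x := by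
        ext x
        rw [walshKernel, smallSubsets_succ, Finset.sum_disjUnion]
        rfl
      have h := abs_cubeMeanAbs_add_sub_le (walshKernel (smallSubsets N d))
        (walshKernel (Finset.powersetCard (d + 1) Finset.univ))
      rw [hk, ← sub_div, Real.norm_eq_abs, abs_div, abs_of_nonneg (by positivity : 0 ≤ √(N : ℝ) ^ (d + 1)),
        div_mul_div_cancel₀ (by positivity)]
      gcongr
    have h := hdiff.add (tendsto_cubeMeanAbs_walshKernel (d + 1))
    simpa using h

lemma tendsto_div_sqrt_of_tendsto {a c : ℕ → ℝ} {d : ℕ} {m : ℝ} (ha : Tendsto (fun N : ℕ =>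
    a N / √(N : ℝ) ^ d) atTop (𝓝 (m / d.factorial)))
    (hc : Tendsto (fun N : ℕ => c N / (N : ℝ) ^ d) atTop (𝓝 (1 / d.factorial))) :
    Tendsto (fun N => a N / √(c N)) atTop (𝓝 (m / √(d.factorial : ℝ))) := by
  have hd : (0 : ℝ) < d.factorial := by positivity
  have h := ha.div hc.sqrt (by positivity)
  have hl : m / d.factorial / √(1 / (d.factorial : ℝ)) = m / √(d.factorial : ℝ) := by
    rw [one_div, Real.sqrt_inv]
    have h1 : √(d.factorial : ℝ) ≠ 0 := by positivity
    field_simp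
    rw [Real.sq_sqrt hd.le]
  rw [hl] at h
  refine h.congr' ?_
  filter_upwards [eventually_ne_atTop 0] with N hN
  have hN' : √(N : ℝ) ≠ 0 := by positivity
  have h2 : √((N : ℝ) ^ d) = √(N : ℝ) ^ d := by
    rw [Real.sqrt_eq_iff_mul_self_eq (by positivity) (by positivity), ← mul_pow,
      Real.mul_self_sqrt (by positivity)]
  rw [Pi.div_apply, Real.sqrt_div' _ (by positivity), h2]
  field_simp

lemma setOf_card_eq (N d : ℕ) : {S : Finset (Fin N) | S.card = d}
    = ((Finset.powersetCard d Finset.univ : Finset (Finset (Fin N))) : Set (Finset (Fin N))) := by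
  ext S
  simp

lemma setOf_card_le (N d : ℕ) : {S : Finset (Fin N) | S.card ≤ d}
    = (smallSubsets N d : Set (Finset (Fin N))) := by
  ext S
  simp [smallSubsets]

lemma projectionConstant_card_eq (N d : ℕ) :
    projectionConstant (BooleanSpace N {S | S.card = d})
      = ENNReal.ofReal (cubeMeanAbs (walshKernel (Finset.powersetCard d (Finset.univ : Finset (Fin N))))) := by
  rw [setOf_card_eq, projectionConstant_booleanSpace]

lemma projectionConstant_card_le (N d : ℕ) :
    projectionConstant (BooleanSpace N {S | S.card ≤ d})
      = ENNReal.ofReal (cubeMeanAbs (walshKernel (smallSubsets N d))) := by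
  rw [setOf_card_le, projectionConstant_booleanSpace]

theorem tendsto_projectionConstant_card_eq (d : ℕ) :
    Tendsto (fun N : ℕ =>
        (projectionConstant (BooleanSpace N {S | S.card = d})).toReal /
          √(Module.finrank ℝ (BooleanSpace N {S | S.card = d}) : ℝ))
      atTop (𝓝 (hermiteIntegral d)) := by
  rw [hermiteIntegral_eq_gaussian]
  have h := tendsto_div_sqrt_of_tendsto (tendsto_cubeMeanAbs_walshKernel d)
    (tendsto_choose_div_pow d)
  refine h.congr fun N => ?_
  have h1 : Module.finrank ℝ (BooleanSpace N {S | S.card = d}) = N.choose d := by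
    rw [setOf_card_eq, finrank_booleanSpace]
    simp
  rw [projectionConstant_card_eq, ENNReal.toReal_ofReal (cubeMeanAbs_nonneg _), h1]

theorem tendsto_projectionConstant_card_le (d : ℕ) :
    Tendsto (fun N : ℕ =>
        (projectionConstant (BooleanSpace N {S | S.card ≤ d})).toReal /
          √(Module.finrank ℝ (BooleanSpace N {S | S.card ≤ d}) : ℝ))
      atTop (𝓝 (hermiteIntegral d)) := by
  rw [hermiteIntegral_eq_gaussian]
  have h := tendsto_div_sqrt_of_tendsto (tendsto_cubeMeanAbs_walshKernel_smallSubsets d)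
    (tendsto_card_smallSubsets d)
  refine h.congr fun N => ?_
  have h1 : Module.finrank ℝ (BooleanSpace N {S | S.card ≤ d}) = (smallSubsets N d).card := by
    rw [setOf_card_le, finrank_booleanSpace]
  rw [projectionConstant_card_le, ENNReal.toReal_ofReal (cubeMeanAbs_nonneg _), h1]

theorem projectionConstant_ne_top (N d : ℕ) :
    projectionConstant (BooleanSpace N {S | S.card = d}) ≠ ⊤ ∧
      projectionConstant (BooleanSpace N {S | S.card ≤ d}) ≠ ⊤ := by
  rw [projectionConstant_card_eq, projectionConstant_card_le]
  exact ⟨ENNReal.ofReal_ne_top, ENNReal.ofReal_ne_top⟩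

end CubeLimit

/-! ### Periodic primitives of mean zero. -/

section PeriodicPrimitive

lemma exists_bound_of_periodic {g : ℝ → ℝ} (hg : Continuous g) (hp : Function.Periodic g Real.pi) :
    ∃ C : ℝ, 0 ≤ C ∧ ∀ s, |g s| ≤ C := by
  obtain ⟨C, hC⟩ := (hp.isBounded_of_continuous Real.pi_ne_zero hg).exists_norm_le
  exact ⟨C, (norm_nonneg _).trans (hC (g 0) ⟨0, rfl⟩), fun s => hC _ ⟨s, rfl⟩⟩

/-- A periodic continuous function with mean zero has a periodic primitive with mean zero. -/
lemma exists_periodic_primitive {g : ℝ → ℝ} (hg : Continuous g)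
    (hp : Function.Periodic g Real.pi) (h0 : ∫ s in (0 : ℝ)..Real.pi, g s = 0) :
    ∃ K : ℝ → ℝ, (∀ s, HasDerivAt K (g s) s) ∧ Function.Periodic K Real.pi ∧
      ∫ s in (0 : ℝ)..Real.pi, K s = 0 := by
  let K₀ : ℝ → ℝ := fun x => ∫ s in (0 : ℝ)..x, g s
  have hK₀ : ∀ s, HasDerivAt K₀ (g s) s := fun s =>
    intervalIntegral.integral_hasDerivAt_right (hg.intervalIntegrable _ _)
      (hg.stronglyMeasurableAtFilter _ _) hg.continuousAt
  have hK₀c : Continuous K₀ := continuous_iff_continuousAt.2 fun s => (hK₀ s).continuousAt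
  -- Subtracting its mean from the primitive lets the construction be iterated.
  let c := (∫ s in (0 : ℝ)..Real.pi, K₀ s) / Real.pi
  refine ⟨fun s => K₀ s - c, fun s => (hK₀ s).sub_const c, fun s => ?_, ?_⟩
  · simp only [K₀]
    rw [← intervalIntegral.integral_add_adjacent_intervals (hg.intervalIntegrable 0 s)
      (hg.intervalIntegrable s (s + Real.pi)), hp.intervalIntegral_add_eq s 0, zero_add, h0, add_zero]
  · rw [intervalIntegral.integral_sub (hK₀c.intervalIntegrable _ _)
      (continuous_const.intervalIntegrable _ _), intervalIntegral.integral_const]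
    simp only [c, sub_zero, smul_eq_mul]
    field_simp
    ring

end PeriodicPrimitive

/-! ### The amplitude of the approximate solutions. -/

section Amplitude

open Polynomial
open scoped Polynomial.Bivariate

/-- The amplitude of the approximate solutions of the Hermite differential equation, as a
polynomial in `q = (d + 1/2)⁻¹` and `t`. -/
noncomputable def amplitudePoly : ℝ[X][Y] :=
  1 + C (C (1 / 16) * X) * Y ^ 2 + C (X ^ 2) * (C (C (5 / 512)) * Y ^ 4 - C (C (1 / 32)))

/-- The polynomial `amplitudePoly` as a function. -/
noncomputable def amplitude (q t : ℝ) : ℝ :=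
  1 + q * t ^ 2 / 16 + q ^ 2 * (5 / 512 * t ^ 4 - 1 / 32)

lemma amplitudePoly_evalEval (q t : ℝ) : amplitudePoly.evalEval q t = amplitude q t := by
  simp only [amplitudePoly, amplitude, evalEval_add, evalEval_one, evalEval_mul, evalEval_C,
    evalEval_pow, evalEval_X, evalEval_sub, eval_mul, eval_C, eval_X, eval_pow]
  ring

/-- The only negative contribution is `-q²/32`. The lower bound holds for all real `t`, so no
turning point interferes. -/
lemma half_le_amplitude {q : ℝ} (hq : q ∈ Set.Icc (0 : ℝ) 1) (t : ℝ) : 1 / 2 ≤ amplitude q t := by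
  obtain ⟨h0, h1⟩ := hq
  have h2 : q ^ 2 ≤ 1 := pow_le_one₀ h0 h1
  have h3 : 0 ≤ q * t ^ 2 / 16 := by positivity
  have h4 : 0 ≤ q ^ 2 * (5 / 512 * t ^ 4) := by positivity
  rw [amplitude]
  nlinarith

lemma continuous_amplitude (q : ℝ) : Continuous (amplitude q) := by
  unfold amplitude
  fun_prop

lemma hasDerivAt_amplitude (q t : ℝ) :
    HasDerivAt (amplitude q) (q * t / 8 + q ^ 2 * (5 / 128 * t ^ 3)) t := by
  have h := (((hasDerivAt_pow 2 t).const_mul q).div_const 16).const_add 1 |>.add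
    ((((hasDerivAt_pow 4 t).const_mul (5 / 512)).sub_const (1 / 32)).const_mul (q ^ 2))
  refine h.congr_deriv ?_
  norm_num
  ring

/-- The remainder in the differential equation for the amplitude, divided by `q³`. -/
noncomputable def amplitudeDefectPoly : ℝ[X][Y] :=
  let b₀ : ℝ[X][Y] := C (C (1 / 16)) * Y ^ 2
  let b₁ : ℝ[X][Y] := C (C (5 / 512)) * Y ^ 4 - C (C (1 / 32))
  let q : ℝ[X][Y] := C X
  let b : ℝ[X][Y] := b₀ + q * b₁
  let e : ℝ[X][Y] := C (C (1 / 8)) + C (C (15 / 128)) * q * Y ^ 2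
  C (C (15 / 128)) * Y ^ 2 + C (C 12) * b₀ * b₁ + C (C 6) * q * b₁ ^ 2 - Y ^ 2 * b₁
    + e * (C (C 3) * b + C (C 3) * q * b ^ 2 + q ^ 2 * b ^ 3) + C (C 4) * b ^ 3 + q * b ^ 4
    - C (C (1 / 4)) * Y ^ 2 * (C (C 6) * b ^ 2 + C (C 4) * q * b ^ 3 + q ^ 2 * b ^ 4)

/-- If `θ' = κ/A²`, then `A cos θ` and `A sin θ` solve `u'' + (κ² - t²/4)u = 0` exactly when `A'' +
(κ² - t²/4)A = κ²/A³`. Multiplied by `q A³` with `q κ² = 1`, this says that the left side equals 1.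
The coefficients 1/16, 5/512 and -1/32 of the amplitude are those that cancel the orders `q` and
`q²`. -/
lemma amplitude_equation (q t : ℝ) :
    q * amplitude q t ^ 3 * (q / 8 + q ^ 2 * (15 / 128 * t ^ 2))
      + (1 - q * t ^ 2 / 4) * amplitude q t ^ 4
      = 1 + q ^ 3 * amplitudeDefectPoly.evalEval q t := by
  simp only [amplitudeDefectPoly, amplitude, evalEval_add, evalEval_mul, evalEval_C,
    evalEval_pow, evalEval_X, evalEval_sub, eval_C, eval_X]
  ring

end Amplitude

/-! ### Averaging over the fast phase. -/

section Averaging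

open Polynomial
open scoped Polynomial.Bivariate

lemma integrable_evalEval_mul_exp_mul (P : ℝ[X][Y]) {q b : ℝ} (hb : 0 < b)
    (hq : q ∈ Set.Icc (0 : ℝ) 1) {G : ℝ → ℝ} (hG : Continuous G) {M : ℝ} (hM : ∀ t, |G t| ≤ M) :
    Integrable fun t => P.evalEval q t * Real.exp (-b * t ^ 2) * G t := by
  obtain ⟨C, hC, K, h⟩ := exists_abs_evalEval_le P
  have hc : Continuous fun t => P.evalEval q t * G t := (continuous_evalEval P q).mul hG
  have hM0 : 0 ≤ M := (abs_nonneg _).trans (hM 0)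
  refine (integrable_mul_exp_of_le hb hc (C := C * M) (K := K) fun t => ?_).congr
    (ae_of_all _ fun t => by simp only; ring)
  rw [abs_mul]
  calc _ ≤ C * (1 + t ^ 2) ^ K * M := mul_le_mul (h q hq t) (hM t) (abs_nonneg _) (by positivity)
    _ = _ := by ring

/-- Oscillating integrals with phase speed `κ / A²` decay faster than any power of `κ`. -/
theorem exists_abs_integral_oscillating_le (m : ℕ) : ∀ {g : ℝ → ℝ}, Continuous g →
    Function.Periodic g Real.pi → ∫ s in (0 : ℝ)..Real.pi, g s = 0 → ∀ P : ℝ[X][Y],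
    ∃ C : ℝ, 0 ≤ C ∧ ∀ q ∈ Set.Icc (0 : ℝ) 1, ∀ κ : ℝ, 0 < κ → ∀ θ : ℝ → ℝ,
      (∀ t, HasDerivAt θ (κ / amplitude q t ^ 2) t) →
      |∫ t, P.evalEval q t * Real.exp (-(1 / 4) * t ^ 2) * g (θ t)| ≤ C / κ ^ m := by
  induction m with
  | zero =>
    intro g hg hp _ P
    obtain ⟨M, hM0, hM⟩ := exists_bound_of_periodic hg hp
    obtain ⟨C, hC, K, h⟩ := exists_abs_evalEval_le P
    have hi := integrable_one_add_sq_pow_mul_exp (b := 1 / 4) (by norm_num) K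
    refine ⟨C * M * ∫ t : ℝ, (1 + t ^ 2) ^ K * Real.exp (-(1 / 4) * t ^ 2), ?_, ?_⟩
    · exact mul_nonneg (mul_nonneg hC hM0) (integral_nonneg fun t => by positivity)
    · intro q hq κ hκ θ hθ
      have hθc : Continuous θ := continuous_iff_continuousAt.2 fun t => (hθ t).continuousAt
      rw [pow_zero, div_one, ← integral_const_mul]
      refine abs_integral_le_integral_abs.trans (integral_mono
        (integrable_evalEval_mul_exp_mul P (by norm_num) hq (hg.comp hθc) fun t => hM _).abs
        (hi.const_mul _) fun t => ?_)
      simp only [abs_mul, abs_of_pos (Real.exp_pos _)]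
      calc _ ≤ C * (1 + t ^ 2) ^ K * Real.exp (-(1 / 4) * t ^ 2) * M := by
            gcongr
            · exact h q hq t
            · exact hM _
        _ = _ := by ring
  | succ m ih =>
    intro g hg hp h0 P
    obtain ⟨K, hK, hKp, hK0⟩ := exists_periodic_primitive hg hp h0
    have hKc : Continuous K := continuous_iff_continuousAt.2 fun s => (hK s).continuousAt
    -- Integration by parts: `K(θ)` has derivative `κ A⁻² g(θ)`, so the factor `A²` is moved into
    -- `P'`. Differentiating `P' e^(-t²/4)` leaves the polynomial `P₁` times the same Gaussian, and
    -- each round gains a factor `1/κ`.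
    let P' : ℝ[X][Y] := P * amplitudePoly ^ 2
    let P₁ : ℝ[X][Y] := derivative P' - C (C (1 / 2)) * Y * P'
    obtain ⟨C, hC, h⟩ := ih hKc hKp hK0 P₁
    refine ⟨C, hC, fun q hq κ hκ θ hθ => ?_⟩
    have hθc : Continuous θ := continuous_iff_continuousAt.2 fun t => (hθ t).continuousAt
    obtain ⟨M, hM0, hM⟩ := exists_bound_of_periodic hg hp
    obtain ⟨M', hM0', hM'⟩ := exists_bound_of_periodic hKc hKp
    have hi := integrable_evalEval_mul_exp_mul P (b := 1 / 4) (by norm_num) hq (hg.comp hθc)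
      fun t => hM _
    have hi₁ := integrable_evalEval_mul_exp_mul P₁ (b := 1 / 4) (by norm_num) hq (hKc.comp hθc)
      fun t => hM' _
    have hi' := integrable_evalEval_mul_exp_mul P' (b := 1 / 4) (by norm_num) hq (hKc.comp hθc)
      fun t => hM' _
    simp only [Function.comp] at hi hi₁ hi'
    have hderiv : ∀ t, HasDerivAt
        (fun t => P'.evalEval q t * Real.exp (-(1 / 4) * t ^ 2) * K (θ t))
        (P₁.evalEval q t * Real.exp (-(1 / 4) * t ^ 2) * K (θ t)
          + κ * (P.evalEval q t * Real.exp (-(1 / 4) * t ^ 2) * g (θ t))) t := by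
      intro t
      have h1 := hasDerivAt_evalEval P' q t
      have h2 : HasDerivAt (fun t : ℝ => Real.exp (-(1 / 4) * t ^ 2))
          (Real.exp (-(1 / 4) * t ^ 2) * (-(1 / 4) * (2 * t))) t := by
        have := ((hasDerivAt_pow 2 t).const_mul (-(1 / 4 : ℝ))).exp
        simpa using this
      have h3 := (hK (θ t)).comp t (hθ t)
      refine ((h1.mul h2).mul h3).congr_deriv ?_
      have hA : amplitude q t ≠ 0 := by
        have := half_le_amplitude hq t
        positivity
      simp only [P₁, P', evalEval_sub, evalEval_mul, evalEval_pow, amplitudePoly_evalEval, evalEval_C,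
        evalEval_X, eval_C, Pi.mul_apply, Function.comp]
      field_simp
      ring
    have hz := integral_eq_zero_of_hasDerivAt_of_integrable hderiv (hi₁.add (hi.const_mul κ)) hi'
    rw [integral_add hi₁ (hi.const_mul κ), integral_const_mul] at hz
    have heq : ∫ t, P.evalEval q t * Real.exp (-(1 / 4) * t ^ 2) * g (θ t)
        = -(∫ t, P₁.evalEval q t * Real.exp (-(1 / 4) * t ^ 2) * K (θ t)) / κ := by
      rw [eq_div_iff hκ.ne']
      linarith
    rw [heq, abs_div, abs_neg, abs_of_pos hκ, pow_succ, ← div_div]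
    gcongr
    exact h q hq κ hκ θ hθ

lemma integral_abs_cos_sub : ∫ s in (0 : ℝ)..Real.pi, (|Real.cos s| - 2 / Real.pi) = 0 := by
  have hc : Continuous fun s : ℝ => |Real.cos s| := Real.continuous_cos.abs
  rw [intervalIntegral.integral_sub (hc.intervalIntegrable _ _)
    (continuous_const.intervalIntegrable _ _), intervalIntegral.integral_const,
    ← intervalIntegral.integral_add_adjacent_intervals (hc.intervalIntegrable 0 (Real.pi / 2))
    (hc.intervalIntegrable (Real.pi / 2) Real.pi)]
  have h1 : ∫ s in (0 : ℝ)..(Real.pi / 2), |Real.cos s| = 1 := by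
    rw [intervalIntegral.integral_congr (g := Real.cos)]
    · simp
    · intro s hs
      rw [Set.uIcc_of_le (by positivity)] at hs
      exact abs_of_nonneg (Real.cos_nonneg_of_mem_Icc ⟨by linarith [hs.1, Real.pi_pos], hs.2⟩)
  have h2 : ∫ s in (Real.pi / 2)..Real.pi, |Real.cos s| = 1 := by
    rw [intervalIntegral.integral_congr (g := fun s => -Real.cos s)]
    · simp
    · intro s hs
      rw [Set.uIcc_of_le (by linarith [Real.pi_pos])] at hs
      exact abs_of_nonpos (Real.cos_nonpos_of_pi_div_two_le_of_le hs.1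
        (by linarith [hs.2, Real.pi_pos]))
  rw [h1, h2, sub_zero, smul_eq_mul]
  field_simp
  norm_num

lemma integral_abs_sin_sub : ∫ s in (0 : ℝ)..Real.pi, (|Real.sin s| - 2 / Real.pi) = 0 := by
  have hc : Continuous fun s : ℝ => |Real.sin s| := Real.continuous_sin.abs
  rw [intervalIntegral.integral_sub (hc.intervalIntegrable _ _)
    (continuous_const.intervalIntegrable _ _), intervalIntegral.integral_const]
  have h1 : ∫ s in (0 : ℝ)..Real.pi, |Real.sin s| = 2 := by
    rw [intervalIntegral.integral_congr (g := Real.sin)]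
    · simp
      norm_num
    · intro s hs
      rw [Set.uIcc_of_le (by positivity)] at hs
      exact abs_of_nonneg (Real.sin_nonneg_of_mem_Icc hs)
  rw [h1, sub_zero, smul_eq_mul]
  field_simp
  norm_num

lemma integral_exp_quarter : ∫ t : ℝ, Real.exp (-(1 / 4) * t ^ 2) = 2 * √Real.pi := by
  rw [integral_gaussian, show Real.pi / (1 / 4) = 2 ^ 2 * Real.pi by ring,
    Real.sqrt_mul (by positivity), Real.sqrt_sq (by norm_num)]

lemma integral_sq_mul_exp_quarter :
    ∫ t : ℝ, t ^ 2 * Real.exp (-(1 / 4) * t ^ 2) = 4 * √Real.pi := by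
  have hi0 : Integrable fun t : ℝ => Real.exp (-(1 / 4) * t ^ 2) :=
    integrable_exp_neg_mul_sq (by norm_num)
  have hb : ∀ t : ℝ, 1 ≤ 1 + t ^ 2 := fun t => by nlinarith [sq_nonneg t]
  have hi1 : Integrable fun t : ℝ => t * Real.exp (-(1 / 4) * t ^ 2) :=
    integrable_mul_exp_of_le (by norm_num) continuous_id (C := 1) (K := 1) fun t => by
      simpa using abs_pow_le_one_add_sq_pow t 1
  have hi2 : Integrable fun t : ℝ => t ^ 2 * Real.exp (-(1 / 4) * t ^ 2) :=
    integrable_mul_exp_of_le (by norm_num) (by fun_prop) (C := 1) (K := 2) fun t => by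
      simpa [abs_pow] using abs_pow_le_one_add_sq_pow t 2
  have hderiv : ∀ t : ℝ, HasDerivAt (fun t : ℝ => t * Real.exp (-(1 / 4) * t ^ 2))
      (Real.exp (-(1 / 4) * t ^ 2) - 1 / 2 * (t ^ 2 * Real.exp (-(1 / 4) * t ^ 2))) t := by
    intro t
    have h := (hasDerivAt_id t).mul ((hasDerivAt_pow 2 t).const_mul (-(1 / 4 : ℝ))).exp
    refine h.congr_deriv ?_
    simp
    ring
  have h := integral_eq_zero_of_hasDerivAt_of_integrable hderiv (hi0.sub (hi2.const_mul _)) hi1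
  rw [integral_sub hi0 (hi2.const_mul _), integral_const_mul, integral_exp_quarter] at h
  linarith

/-- The average of the modulus of the approximate solutions. -/
theorem exists_abs_integral_amplitude_sub_le {g : ℝ → ℝ} (hg : Continuous g)
    (hp : Function.Periodic g Real.pi)
    (h0 : ∫ s in (0 : ℝ)..Real.pi, (g s - 2 / Real.pi) = 0) :
    ∃ C : ℝ, 0 ≤ C ∧ ∀ q ∈ Set.Icc (0 : ℝ) 1, ∀ κ : ℝ, 0 < κ → q * κ ^ 2 = 1 → ∀ θ : ℝ → ℝ,
      (∀ t, HasDerivAt θ (κ / amplitude q t ^ 2) t) →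
      |(∫ t, amplitude q t * Real.exp (-(1 / 4) * t ^ 2) * g (θ t))
        - 4 / √Real.pi * (1 + q / 8)| ≤ C * q ^ 2 := by
  -- Four integrations by parts, because `κ⁻⁴ = q²` is the precision aimed at.
  obtain ⟨C, hC, h⟩ := exists_abs_integral_oscillating_le 4 (g := fun s => g s - 2 / Real.pi)
    (by fun_prop) (fun s => by simp [hp s]) h0 amplitudePoly
  let D := |∫ t : ℝ, (5 / 512 * t ^ 4 - 1 / 32) * Real.exp (-(1 / 4) * t ^ 2)|
  refine ⟨C + 2 / Real.pi * D, by positivity, fun q hq κ hκ hqκ θ hθ => ?_⟩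
  have hθc : Continuous θ := continuous_iff_continuousAt.2 fun t => (hθ t).continuousAt
  have h1 := h q hq κ hκ θ hθ
  simp only [amplitudePoly_evalEval] at h1
  obtain ⟨M, hM0, hM⟩ := exists_bound_of_periodic hg hp
  have hig := integrable_evalEval_mul_exp_mul amplitudePoly (b := 1 / 4) (by norm_num) hq
    (hg.comp hθc) fun t => hM _
  have hi1 := integrable_evalEval_mul_exp_mul amplitudePoly (b := 1 / 4) (by norm_num) hq
    (continuous_const (y := 2 / Real.pi)) fun t => le_refl _
  simp only [amplitudePoly_evalEval, Function.comp] at hig hi1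
  simp only [mul_sub] at h1
  rw [integral_sub hig hi1, integral_mul_const] at h1
  have hi0 : Integrable fun t : ℝ => Real.exp (-(1 / 4) * t ^ 2) :=
    integrable_exp_neg_mul_sq (by norm_num)
  have hi2 : Integrable fun t : ℝ => t ^ 2 * Real.exp (-(1 / 4) * t ^ 2) :=
    integrable_mul_exp_of_le (by norm_num) (by fun_prop) (C := 1) (K := 2) fun t => by
      simpa [abs_pow] using abs_pow_le_one_add_sq_pow t 2
  have hi4 : Integrable fun t : ℝ => t ^ 4 * Real.exp (-(1 / 4) * t ^ 2) :=
    integrable_mul_exp_of_le (by norm_num) (by fun_prop) (C := 1) (K := 4) fun t => by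
      simpa [abs_pow] using abs_pow_le_one_add_sq_pow t 4
  have hi3 : Integrable fun t : ℝ => (5 / 512 * t ^ 4 - 1 / 32) * Real.exp (-(1 / 4) * t ^ 2) :=
    ((hi4.const_mul (5 / 512)).sub (hi0.const_mul (1 / 32))).congr
      (ae_of_all _ fun t => by simp only [Pi.sub_apply]; ring)
  -- The moments `2√π` and `4√π` turn `1 + q t²/16` into `2√π (1 + q/8)`.
  have hA : ∫ t, amplitude q t * Real.exp (-(1 / 4) * t ^ 2) = 2 * √Real.pi * (1 + q / 8)
      + q ^ 2 * ∫ t : ℝ, (5 / 512 * t ^ 4 - 1 / 32) * Real.exp (-(1 / 4) * t ^ 2) := by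
    have : ∀ t : ℝ, amplitude q t * Real.exp (-(1 / 4) * t ^ 2) = (Real.exp (-(1 / 4) * t ^ 2)
        + q / 16 * (t ^ 2 * Real.exp (-(1 / 4) * t ^ 2)))
        + q ^ 2 * ((5 / 512 * t ^ 4 - 1 / 32) * Real.exp (-(1 / 4) * t ^ 2)) := fun t => by
      rw [amplitude]
      ring
    simp_rw [this]
    have hi02 : Integrable fun t : ℝ => Real.exp (-(1 / 4) * t ^ 2)
        + q / 16 * (t ^ 2 * Real.exp (-(1 / 4) * t ^ 2)) := hi0.add (hi2.const_mul _)
    rw [integral_add hi02 (hi3.const_mul _), integral_add hi0 (hi2.const_mul _), integral_const_mul, integral_const_mul, integral_exp_quarter, integral_sq_mul_exp_quarter]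
    ring
  rw [hA] at h1
  have hκ4 : C / κ ^ 4 = C * q ^ 2 := by
    rw [div_eq_iff (by positivity)]
    calc C = C * (q * κ ^ 2) ^ 2 := by rw [hqκ]; ring
      _ = _ := by ring
  rw [hκ4] at h1
  have hpi : √Real.pi * √Real.pi = Real.pi := Real.mul_self_sqrt Real.pi_pos.le
  have hs : 2 * √Real.pi * (2 / Real.pi) = 4 / √Real.pi := by
    have h2 : √Real.pi ≠ 0 := by positivity
    rw [eq_div_iff h2]
    field_simp
    linear_combination 4 * hpi
  set J := ∫ t : ℝ, (5 / 512 * t ^ 4 - 1 / 32) * Real.exp (-(1 / 4) * t ^ 2)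
  set L := ∫ t, amplitude q t * Real.exp (-(1 / 4) * t ^ 2) * g (θ t)
  have hsplit : L - 4 / √Real.pi * (1 + q / 8)
      = (L - (2 * √Real.pi * (1 + q / 8) + q ^ 2 * J) * (2 / Real.pi)) + q ^ 2 * (2 / Real.pi * J) := by
    rw [← hs]
    ring
  rw [hsplit, add_mul C]
  refine (abs_add_le _ _).trans (add_le_add h1 (le_of_eq ?_))
  rw [abs_mul, abs_mul, abs_of_nonneg (sq_nonneg q), abs_of_pos (by positivity : 0 < 2 / Real.pi)]
  ring

end Averaging

/-! ### Comparison of exact and approximate solutions of the oscillator equation. -/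

section OscillatorComparison

lemma exists_phase {q : ℝ} (hq : q ∈ Set.Icc (0 : ℝ) 1) (κ : ℝ) :
    ∃ θ : ℝ → ℝ, θ 0 = 0 ∧ ∀ t, HasDerivAt θ (κ / amplitude q t ^ 2) t := by
  have hc : Continuous fun t => κ / amplitude q t ^ 2 :=
    continuous_const.div ((continuous_amplitude q).pow 2) fun t => by
      have := half_le_amplitude hq t
      positivity
  refine ⟨fun x => ∫ t in (0 : ℝ)..x, κ / amplitude q t ^ 2, by simp, fun t => ?_⟩
  exact intervalIntegral.integral_hasDerivAt_right (hc.intervalIntegrable _ _)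
    (hc.stronglyMeasurableAtFilter _ _) hc.continuousAt

lemma hasDerivAt_deriv_amplitude (q t : ℝ) :
    HasDerivAt (fun t => q * t / 8 + q ^ 2 * (5 / 128 * t ^ 3))
      (q / 8 + q ^ 2 * (15 / 128 * t ^ 2)) t := by
  have h := (((hasDerivAt_id t).const_mul q).div_const 8).add
    (((hasDerivAt_pow 3 t).const_mul (5 / 128)).const_mul (q ^ 2))
  refine h.congr_deriv ?_
  rw [show 3 - 1 = 2 from rfl]
  push_cast
  ring

/-- Variation of constants: the coefficients of a solution of `u'' + (κ² - t²/4) u = 0` with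
respect to the approximate solutions `A cos θ` and `A sin θ` have small derivatives. -/
lemma exists_slow_coefficients {q κ : ℝ} (hq : q ∈ Set.Icc (0 : ℝ) 1) (hκ : 0 < κ)
    (hqκ : q * κ ^ 2 = 1) {θ u v : ℝ → ℝ} (hθ0 : θ 0 = 0)
    (hθ : ∀ t, HasDerivAt θ (κ / amplitude q t ^ 2) t) (hu : ∀ t, HasDerivAt u (v t) t)
    (hv : ∀ t, HasDerivAt v (-(κ ^ 2 - t ^ 2 / 4) * u t) t) :
    ∃ α β : ℝ → ℝ, α 0 = u 0 / amplitude q 0 ∧ β 0 = v 0 * amplitude q 0 / κ ∧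
      (∀ t, u t / amplitude q t = α t * Real.cos (θ t) + β t * Real.sin (θ t)) ∧
      (∀ t, HasDerivAt α (κ / amplitude q t ^ 2 * (q ^ 3 * amplitudeDefectPoly.evalEval q t)
        * (u t / amplitude q t) * Real.sin (θ t)) t) ∧
      (∀ t, HasDerivAt β (-(κ / amplitude q t ^ 2 * (q ^ 3 * amplitudeDefectPoly.evalEval q t)
        * (u t / amplitude q t) * Real.cos (θ t))) t) := by
  have hA : ∀ t, amplitude q t ≠ 0 := fun t => by
    have := half_le_amplitude hq t
    positivity
  set A' : ℝ → ℝ := fun t => q * t / 8 + q ^ 2 * (5 / 128 * t ^ 3) with hA'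
  set y : ℝ → ℝ := fun t => u t / amplitude q t with hy
  -- This is the derivative of `y = u/A` with respect to the phase `θ`. In the variable `θ`, the
  -- pair `(y, z)` obeys the equation of a unit rotation, up to the defect of order `q³`.
  set z : ℝ → ℝ := fun t => (v t * amplitude q t - u t * A' t) / κ with hz
  have hyd : ∀ t, HasDerivAt y (κ / amplitude q t ^ 2 * z t) t := fun t => by
    refine ((hu t).div (hasDerivAt_amplitude q t) (hA t)).congr_deriv ?_
    simp only [hz, hA']
    have := hA t
    field_simp
  have hzd : ∀ t, HasDerivAt z (-(κ / amplitude q t ^ 2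
      * (1 + q ^ 3 * amplitudeDefectPoly.evalEval q t) * y t)) t := fun t => by
    have h := (((hv t).mul (hasDerivAt_amplitude q t)).sub
      ((hu t).mul (hasDerivAt_deriv_amplitude q t))).div_const κ
    refine h.congr_deriv ?_
    have hAt := hA t
    rw [← amplitude_equation]
    simp only [hy]
    field_simp
    linear_combination
      u t * (480 * t ^ 2 * q ^ 2 + 512 * q - 1024 * t ^ 2 * amplitude q t) * hqκ
  have hsc : ∀ t, Real.sin (θ t) ^ 2 + Real.cos (θ t) ^ 2 = 1 := fun t => Real.sin_sq_add_cos_sq _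
  -- Rotating `(y, z)` back by the angle `θ` removes the unperturbed motion, so that only the defect
  -- drives `α` and `β`.
  refine ⟨fun t => y t * Real.cos (θ t) - z t * Real.sin (θ t),
    fun t => y t * Real.sin (θ t) + z t * Real.cos (θ t), ?_, ?_, fun t => ?_, fun t => ?_,
    fun t => ?_⟩
  · simp [hθ0, hy]
  · simp [hθ0, hz, hA']
  · linear_combination (-y t) * hsc t
  · refine (((hyd t).mul (hθ t).cos).sub ((hzd t).mul (hθ t).sin)).congr_deriv ?_
    ring
  · refine (((hyd t).mul (hθ t).sin).add ((hzd t).mul (hθ t).cos)).congr_deriv ?_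
    ring

/-- The coefficients `α`, `β` drift at a rate of order `κ q³ = κ⁻⁵` times the size of `u/A`. That
size is its maximum on `[-|t|, |t|]`, and the smallness hypothesis allows the drift to be absorbed
into it, bounding the maximum by the initial data. -/
theorem exists_abs_sub_oscillation_le :
    ∃ C : ℝ, 0 ≤ C ∧ ∃ K : ℕ, ∀ q ∈ Set.Icc (0 : ℝ) 1, ∀ κ : ℝ, 0 < κ → q * κ ^ 2 = 1 →
      ∀ θ u v : ℝ → ℝ, θ 0 = 0 → (∀ t, HasDerivAt θ (κ / amplitude q t ^ 2) t) →
      (∀ t, HasDerivAt u (v t) t) → (∀ t, HasDerivAt v (-(κ ^ 2 - t ^ 2 / 4) * u t) t) →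
      ∀ t, C / κ ^ 5 * (1 + t ^ 2) ^ K ≤ 1 →
        |u t / amplitude q t - (u 0 / amplitude q 0 * Real.cos (θ t)
          + v 0 * amplitude q 0 / κ * Real.sin (θ t))|
          ≤ C / κ ^ 5 * (1 + t ^ 2) ^ K * (|u 0 / amplitude q 0| + |v 0 * amplitude q 0 / κ|) := by
  obtain ⟨C, hC, K, hB⟩ := exists_abs_evalEval_le amplitudeDefectPoly
  -- The 16 is 4 from `1/A² ≤ 4`, times 2 for the cosine and sine terms, times 2 from the bound
  -- `hMle` on the maximum. The additional power of `1 + t²` bounds the length `|t|` of the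
  -- interval.
  refine ⟨16 * C, by positivity, K + 1, fun q hq κ hκ hqκ θ u v hθ0 hθ hu hv t hsmall => ?_⟩
  obtain ⟨α, β, hα0, hβ0, hαβ, hα, hβ⟩ := exists_slow_coefficients hq hκ hqκ hθ0 hθ hu hv
  set T := |t| with hT
  have hT0 : 0 ≤ T := abs_nonneg t
  have htT : t ∈ Set.Icc (-T) T := abs_le.1 le_rfl
  have h0T : (0 : ℝ) ∈ Set.Icc (-T) T := ⟨by linarith, hT0⟩
  have hT2 : T ^ 2 = t ^ 2 := sq_abs t
  have hA : ∀ t, 1 / 2 ≤ amplitude q t := half_le_amplitude hq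
  have hAne : ∀ t, amplitude q t ≠ 0 := fun t => by
    have := hA t
    positivity
  have huc : Continuous fun t => u t / amplitude q t :=
    (continuous_iff_continuousAt.2 fun t => (hu t).continuousAt).div (continuous_amplitude q) hAne
  obtain ⟨t₀, ht₀, hmax⟩ := (isCompact_Icc (a := -T) (b := T)).exists_isMaxOn ⟨0, h0T⟩
    huc.abs.continuousOn
  set M := |u t₀ / amplitude q t₀|
  have hM : ∀ s ∈ Set.Icc (-T) T, |u s / amplitude q s| ≤ M := fun s hs => hmax hs
  have hM0 : 0 ≤ M := abs_nonneg _
  set L := 4 * C / κ ^ 5 * (1 + t ^ 2) ^ K * M with hL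
  have hL0 : 0 ≤ L := by positivity
  have hcoef : ∀ s ∈ Set.Icc (-T) T, |κ / amplitude q s ^ 2
      * (q ^ 3 * amplitudeDefectPoly.evalEval q s) * (u s / amplitude q s)| ≤ L := by
    intro s hs
    have hs2 : s ^ 2 ≤ t ^ 2 := by
      rw [← hT2]
      exact sq_le_sq' hs.1 hs.2
    have hq0 := hq.1
    have h1 : κ / amplitude q s ^ 2 ≤ 4 * κ := by
      rw [div_le_iff₀ (by have := hA s; positivity)]
      have : 1 ≤ 4 * amplitude q s ^ 2 := by nlinarith [hA s]
      nlinarith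
    have h2 : κ * q ^ 3 = 1 / κ ^ 5 := by
      rw [eq_div_iff (by positivity)]
      calc κ * q ^ 3 * κ ^ 5 = (q * κ ^ 2) ^ 3 := by ring
        _ = 1 := by rw [hqκ]; ring
    rw [abs_mul, abs_mul, abs_mul, abs_of_nonneg (by positivity : 0 ≤ q ^ 3),
      abs_of_nonneg (by positivity : 0 ≤ κ / amplitude q s ^ 2)]
    calc κ / amplitude q s ^ 2 * (q ^ 3 * |amplitudeDefectPoly.evalEval q s|)
          * |u s / amplitude q s|
        ≤ 4 * κ * (q ^ 3 * (C * (1 + s ^ 2) ^ K)) * M := by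
          gcongr
          · exact hB q hq s
          · exact hM s hs
      _ ≤ 4 * κ * (q ^ 3 * (C * (1 + t ^ 2) ^ K)) * M := by gcongr
      _ = 4 * C * (κ * q ^ 3) * (1 + t ^ 2) ^ K * M := by ring
      _ = L := by rw [h2, hL]; ring
  have hvar : ∀ s ∈ Set.Icc (-T) T, |α s - α 0| ≤ L * T ∧ |β s - β 0| ≤ L * T := by
    intro s hs
    have hsT : ‖s - 0‖ ≤ T := by
      rw [sub_zero, Real.norm_eq_abs]
      exact abs_le.2 hs
    constructor
    · refine ((convex_Icc (-T) T).norm_image_sub_le_of_norm_hasDerivWithin_le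
        (fun x _ => (hα x).hasDerivWithinAt) (fun x hx => ?_) h0T hs).trans
        (mul_le_mul_of_nonneg_left hsT hL0)
      rw [norm_mul]
      exact (mul_le_of_le_one_right (norm_nonneg _) (Real.abs_sin_le_one _)).trans (hcoef x hx)
    · refine ((convex_Icc (-T) T).norm_image_sub_le_of_norm_hasDerivWithin_le
        (fun x _ => (hβ x).hasDerivWithinAt) (fun x hx => ?_) h0T hs).trans
        (mul_le_mul_of_nonneg_left hsT hL0)
      rw [norm_neg, norm_mul]
      exact (mul_le_of_le_one_right (norm_nonneg _) (Real.abs_cos_le_one _)).trans (hcoef x hx)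
  set δ := 16 * C / κ ^ 5 * (1 + t ^ 2) ^ (K + 1) with hδ
  have hLT : 2 * (L * T) ≤ δ / 2 * M := by
    have hTle : T ≤ 1 + t ^ 2 := by
      rw [← hT2]
      nlinarith [sq_nonneg (T - 1)]
    calc 2 * (L * T) ≤ 2 * (L * (1 + t ^ 2)) := by gcongr
      _ = δ / 2 * M := by rw [hL, hδ]; ring
  have hdiff : ∀ s ∈ Set.Icc (-T) T, |u s / amplitude q s
      - (α 0 * Real.cos (θ s) + β 0 * Real.sin (θ s))| ≤ δ / 2 * M := by
    intro s hs
    refine le_trans ?_ hLT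
    rw [hαβ s, show α s * Real.cos (θ s) + β s * Real.sin (θ s)
      - (α 0 * Real.cos (θ s) + β 0 * Real.sin (θ s))
      = (α s - α 0) * Real.cos (θ s) + (β s - β 0) * Real.sin (θ s) by ring, two_mul]
    refine (abs_add_le _ _).trans (add_le_add ?_ ?_)
    · rw [abs_mul]
      exact (mul_le_of_le_one_right (abs_nonneg _) (Real.abs_cos_le_one _)).trans (hvar s hs).1
    · rw [abs_mul]
      exact (mul_le_of_le_one_right (abs_nonneg _) (Real.abs_sin_le_one _)).trans (hvar s hs).2
  -- At the maximum point the deviation is at most `M / 2`, which is moved to the left side.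
  have hMle : M ≤ 2 * (|α 0| + |β 0|) := by
    have h1 := hdiff t₀ ht₀
    have h2 : |α 0 * Real.cos (θ t₀) + β 0 * Real.sin (θ t₀)| ≤ |α 0| + |β 0| := by
      refine (abs_add_le _ _).trans (add_le_add ?_ ?_)
      · rw [abs_mul]
        exact mul_le_of_le_one_right (abs_nonneg _) (Real.abs_cos_le_one _)
      · rw [abs_mul]
        exact mul_le_of_le_one_right (abs_nonneg _) (Real.abs_sin_le_one _)
    have h3 := abs_sub_abs_le_abs_sub (u t₀ / amplitude q t₀)
      (α 0 * Real.cos (θ t₀) + β 0 * Real.sin (θ t₀))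
    have h4 : δ / 2 * M ≤ 1 / 2 * M := by gcongr
    change M - _ ≤ _ at h3
    linarith
  rw [← hα0, ← hβ0]
  refine (hdiff t htT).trans ?_
  calc δ / 2 * M ≤ δ / 2 * (2 * (|α 0| + |β 0|)) := by
        gcongr
    _ = _ := by ring

end OscillatorComparison

/-! ### Hermite functions and their oscillatory approximation. -/

section HermiteWave

lemma hasDerivAt_hermiteFun (n : ℕ) (t : ℝ) :
    HasDerivAt (hermiteFun n) (t * hermiteFun n t - hermiteFun (n + 1) t) t := by
  have h := (Polynomial.hermite n).hasDerivAt_aeval t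
  refine h.congr_deriv ?_
  simp only [hermiteFun]
  rw [Polynomial.hermite_succ n, map_sub, map_mul, Polynomial.aeval_X]
  ring

lemma hasDerivAt_exp_neg_mul_sq (b t : ℝ) :
    HasDerivAt (fun t : ℝ => Real.exp (-b * t ^ 2)) (-(2 * b * t) * Real.exp (-b * t ^ 2)) t := by
  have h := ((hasDerivAt_pow 2 t).const_mul (-b)).exp
  refine h.congr_deriv ?_
  rw [show 2 - 1 = 1 from rfl]
  push_cast
  ring

lemma exists_abs_hermiteFun_mul_le (m n : ℕ) :
    ∃ C : ℝ, ∃ K : ℕ, ∀ t : ℝ, |hermiteFun m t * hermiteFun n t| ≤ C * (1 + t ^ 2) ^ K := by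
  obtain ⟨C, hC, K, h⟩ := exists_abs_hermiteFun_le m
  obtain ⟨C', hC', K', h'⟩ := exists_abs_hermiteFun_le n
  refine ⟨C * C', K + K', fun t => ?_⟩
  rw [abs_mul]
  calc _ ≤ (C * (1 + t ^ 2) ^ K) * (C' * (1 + t ^ 2) ^ K') :=
        mul_le_mul (h t) (h' t) (abs_nonneg _) (by positivity)
    _ = _ := by ring

lemma integrable_hermiteFun_mul (m n : ℕ) :
    Integrable fun t : ℝ => hermiteFun m t * hermiteFun n t * Real.exp (-(1 / 2) * t ^ 2) := by
  obtain ⟨C, K, h⟩ := exists_abs_hermiteFun_mul_le m n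
  exact integrable_mul_exp_of_le (by norm_num)
    ((continuous_hermiteFun m).mul (continuous_hermiteFun n)) h

/-- The derivative of `h_n h_{n+1} e^(-t²/2)` is `((n+1) h_n² - h_{n+1}²) e^(-t²/2)`, and its
integral vanishes. -/
theorem integral_hermiteFun_sq (n : ℕ) :
    ∫ t : ℝ, hermiteFun n t * hermiteFun n t * Real.exp (-(1 / 2) * t ^ 2)
      = n.factorial * √(2 * Real.pi) := by
  induction n with
  | zero =>
    simp only [hermiteFun_zero, one_mul, Nat.factorial_zero, Nat.cast_one]
    rw [integral_gaussian]
    congr 1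
    ring
  | succ n ih =>
    have hderiv : ∀ t : ℝ, HasDerivAt
        (fun t => hermiteFun n t * hermiteFun (n + 1) t * Real.exp (-(1 / 2) * t ^ 2))
        ((n + 1) * (hermiteFun n t * hermiteFun n t * Real.exp (-(1 / 2) * t ^ 2))
          - hermiteFun (n + 1) t * hermiteFun (n + 1) t * Real.exp (-(1 / 2) * t ^ 2)) t := by
      intro t
      refine (((hasDerivAt_hermiteFun n t).mul (hasDerivAt_hermiteFun_succ n t)).mul
        (hasDerivAt_exp_neg_mul_sq (1 / 2) t)).congr_deriv ?_
      simp only [Pi.mul_apply]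
      ring
    have h := integral_eq_zero_of_hasDerivAt_of_integrable hderiv
      (((integrable_hermiteFun_mul n n).const_mul _).sub (integrable_hermiteFun_mul _ _))
      (integrable_hermiteFun_mul n (n + 1))
    rw [integral_sub ((integrable_hermiteFun_mul n n).const_mul _) (integrable_hermiteFun_mul _ _),
      integral_const_mul, ih] at h
    rw [Nat.factorial_succ]
    push_cast
    linarith

/-- The normalized Hermite function `h_d(t) e^{-t²/4} / √(d!)`. -/
noncomputable def hermiteWave (d : ℕ) (t : ℝ) : ℝ :=
  hermiteFun d t * Real.exp (-(1 / 4) * t ^ 2) / √(d.factorial : ℝ)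

/-- The derivative of `hermiteWave d`. -/
noncomputable def hermiteWaveDeriv (d : ℕ) (t : ℝ) : ℝ :=
  (t / 2 * hermiteFun d t - hermiteFun (d + 1) t) * Real.exp (-(1 / 4) * t ^ 2)
    / √(d.factorial : ℝ)

lemma hasDerivAt_hermiteWave (d : ℕ) (t : ℝ) :
    HasDerivAt (hermiteWave d) (hermiteWaveDeriv d t) t := by
  refine (((hasDerivAt_hermiteFun d t).mul (hasDerivAt_exp_neg_mul_sq (1 / 4) t)).div_const
    _).congr_deriv ?_
  rw [hermiteWaveDeriv]
  ring

/-- The harmonic oscillator equation with `κ² = d + 1/2`, the input of the comparison above. -/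
lemma hasDerivAt_hermiteWaveDeriv (d : ℕ) (t : ℝ) :
    HasDerivAt (hermiteWaveDeriv d) (-((d : ℝ) + 1 / 2 - t ^ 2 / 4) * hermiteWave d t) t := by
  refine ((((((hasDerivAt_id t).div_const 2).mul (hasDerivAt_hermiteFun d t)).sub
    (hasDerivAt_hermiteFun_succ d t)).mul (hasDerivAt_exp_neg_mul_sq (1 / 4) t)).div_const
    _).congr_deriv ?_
  simp only [hermiteWave, Pi.mul_apply, Pi.sub_apply, id]
  ring

lemma exp_quarter_mul_self (t : ℝ) :
    Real.exp (-(1 / 4) * t ^ 2) * Real.exp (-(1 / 4) * t ^ 2) = Real.exp (-(1 / 2) * t ^ 2) := by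
  rw [← Real.exp_add]
  congr 1
  ring

lemma hermiteWave_sq (d : ℕ) (t : ℝ) : hermiteWave d t ^ 2
    = hermiteFun d t * hermiteFun d t * Real.exp (-(1 / 2) * t ^ 2) / d.factorial := by
  rw [hermiteWave, div_pow, Real.sq_sqrt (by positivity), ← exp_quarter_mul_self]
  ring

lemma integrable_hermiteWave_sq (d : ℕ) : Integrable fun t => hermiteWave d t ^ 2 := by
  simp_rw [hermiteWave_sq]
  exact (integrable_hermiteFun_mul d d).div_const _

lemma integral_hermiteWave_sq (d : ℕ) : ∫ t, hermiteWave d t ^ 2 = √(2 * Real.pi) := by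
  simp_rw [hermiteWave_sq]
  rw [integral_div, integral_hermiteFun_sq]
  have : (d.factorial : ℝ) ≠ 0 := by positivity
  field_simp

lemma hermiteWave_mul_exp (d : ℕ) (t : ℝ) : hermiteWave d t * Real.exp (-(1 / 4) * t ^ 2)
    = hermiteFun d t * Real.exp (-(1 / 2) * t ^ 2) / √(d.factorial : ℝ) := by
  rw [hermiteWave, ← exp_quarter_mul_self]
  ring

lemma integrable_abs_hermiteWave_mul_exp (d : ℕ) :
    Integrable fun t => |hermiteWave d t| * Real.exp (-(1 / 4) * t ^ 2) := by
  have h := ((integrable_hermiteFun_mul_exp (b := 1 / 2) (by norm_num) d).div_const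
    √(d.factorial : ℝ)).abs
  refine h.congr (ae_of_all _ fun t => ?_)
  simp only
  rw [← hermiteWave_mul_exp, abs_mul, abs_of_pos (Real.exp_pos _)]

lemma hermiteIntegral_eq_hermiteWave (d : ℕ) : hermiteIntegral d
    = 1 / √(2 * Real.pi) * ∫ t, |hermiteWave d t| * Real.exp (-(1 / 4) * t ^ 2) := by
  rw [hermiteIntegral]
  congr 1
  refine integral_congr_ae (ae_of_all _ fun t => ?_)
  simp only
  rw [← abs_of_pos (Real.exp_pos (-(1 / 4) * t ^ 2)), ← abs_mul, hermiteWave_mul_exp, abs_div,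
    abs_mul, abs_of_pos (Real.exp_pos _), abs_of_nonneg (Real.sqrt_nonneg _), hermiteIntegrand,
    hermiteFun, show -(1 / 2) * t ^ 2 = -t ^ 2 / 2 by ring]
  ring

/-- The `L¹`-norm of a Hermite function is that of its oscillatory approximation, up to a small
error. -/
theorem exists_abs_integral_hermiteWave_sub_le {g : ℝ → ℝ} (hg : Continuous g)
    (hp : Function.Periodic g Real.pi)
    (h0 : ∫ s in (0 : ℝ)..Real.pi, (g s - 2 / Real.pi) = 0) :
    ∃ C : ℝ, 0 ≤ C ∧ ∀ d : ℕ, 1 ≤ d → ∀ q κ c : ℝ, q = 1 / ((d : ℝ) + 1 / 2) → 0 < κ →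
      κ ^ 2 = (d : ℝ) + 1 / 2 → 0 ≤ c →
      (∀ s, |hermiteWave d 0 / amplitude q 0 * Real.cos s
        + hermiteWaveDeriv d 0 * amplitude q 0 / κ * Real.sin s| = c * g s) →
      |hermiteWave d 0 / amplitude q 0| + |hermiteWaveDeriv d 0 * amplitude q 0 / κ| = c →
      |(∫ t, |hermiteWave d t| * Real.exp (-(1 / 4) * t ^ 2)) - c * (4 / √Real.pi * (1 + q / 8))|
        ≤ C * (c * q ^ 2 + (1 + c) / κ ^ 5) := by
  obtain ⟨C₁, hC₁, h₁⟩ := exists_abs_integral_amplitude_sub_le hg hp h0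
  obtain ⟨C₂, hC₂, K, h₂⟩ := exists_abs_sub_oscillation_le
  obtain ⟨C₃, hC₃, K₃, h₃⟩ := exists_abs_evalEval_le amplitudePoly
  obtain ⟨M, hM0, hM⟩ := exists_bound_of_periodic hg hp
  have hiA := integrable_one_add_sq_pow_mul_exp (b := 1 / 4) (by norm_num) (K + K₃)
  have hiB := integrable_one_add_sq_pow_mul_exp (b := 1 / 2) (by norm_num) (2 * K)
  set JA := ∫ t : ℝ, (1 + t ^ 2) ^ (K + K₃) * Real.exp (-(1 / 4) * t ^ 2)
  set JB := ∫ t : ℝ, (1 + t ^ 2) ^ (2 * K) * Real.exp (-(1 / 2) * t ^ 2)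
  have hJA : 0 ≤ JA := integral_nonneg fun t => by positivity
  have hJB : 0 ≤ JB := integral_nonneg fun t => by positivity
  refine ⟨C₁ + C₂ * (C₃ * JA + (√(2 * Real.pi) + JB) / 2), by positivity,
    fun d hd q κ c hq hκ hκ2 hc hcs hc' => ?_⟩
  have hd' : (1 : ℝ) ≤ d := by exact_mod_cast hd
  have hqI : q ∈ Set.Icc (0 : ℝ) 1 := by
    rw [hq]
    refine ⟨by positivity, ?_⟩
    rw [div_le_one (by positivity)]
    linarith
  have hqκ : q * κ ^ 2 = 1 := by
    rw [hq, hκ2]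
    field_simp
  obtain ⟨θ, hθ0, hθ⟩ := exists_phase hqI κ
  have hθc : Continuous θ := continuous_iff_continuousAt.2 fun t => (hθ t).continuousAt
  set u := hermiteWave d
  set v := hermiteWaveDeriv d
  have h₁' := h₁ q hqI κ hκ hqκ θ hθ
  have h₂' := h₂ q hqI κ hκ hqκ θ u v hθ0 hθ (hasDerivAt_hermiteWave d) (fun t => by
    rw [hκ2]; exact hasDerivAt_hermiteWaveDeriv d t)
  have hA : ∀ t, 1 / 2 ≤ amplitude q t := half_le_amplitude hqI
  have hA3 : ∀ t, amplitude q t ≤ C₃ * (1 + t ^ 2) ^ K₃ := fun t => by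
    have := h₃ q hqI t
    rw [amplitudePoly_evalEval] at this
    exact (le_abs_self _).trans this
  set e : ℝ → ℝ := fun t => Real.exp (-(1 / 4) * t ^ 2)
  have hgθ : ∀ t, c * g (θ t) ≤ c := fun t => by
    rw [← hcs]
    refine (abs_add_le _ _).trans (le_trans (add_le_add ?_ ?_) hc'.le)
    · rw [abs_mul]
      exact mul_le_of_le_one_right (abs_nonneg _) (Real.abs_cos_le_one _)
    · rw [abs_mul]
      exact mul_le_of_le_one_right (abs_nonneg _) (Real.abs_sin_le_one _)
  have hgθ0 : ∀ t, 0 ≤ c * g (θ t) := fun t => by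
    rw [← hcs]
    exact abs_nonneg _
  set F : ℝ → ℝ := fun t => |u t| * e t - c * (amplitude q t * e t * g (θ t)) with hF
  have hpoint : ∀ t, |F t| ≤ C₂ / κ ^ 5 * (C₃ * c * ((1 + t ^ 2) ^ (K + K₃) * e t)
      + (u t ^ 2 + (1 + t ^ 2) ^ (2 * K) * Real.exp (-(1 / 2) * t ^ 2)) / 2) := by
    intro t
    have hAt := hA t
    have het : 0 < e t := Real.exp_pos _
    have hmain : 0 ≤ C₂ / κ ^ 5 * (C₃ * c * ((1 + t ^ 2) ^ (K + K₃) * e t)) := by positivity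
    have hrest : 0 ≤ C₂ / κ ^ 5 * ((u t ^ 2
      + (1 + t ^ 2) ^ (2 * K) * Real.exp (-(1 / 2) * t ^ 2)) / 2) := by positivity
    rw [mul_add]
    -- Where the comparison estimate is available, it gives the first summand. Where it is not, `C₂
    -- / κ ^ 5 * (1 + t ^ 2) ^ K` exceeds 1, so multiplying the trivial bound by it yields an
    -- estimate of the same order.
    by_cases hsmall : C₂ / κ ^ 5 * (1 + t ^ 2) ^ K ≤ 1
    · refine le_trans ?_ (le_add_of_nonneg_right hrest)
      have h := h₂' t hsmall
      rw [hc'] at h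
      have h4 := (abs_abs_sub_abs_le_abs_sub _ _).trans h
      rw [hcs, abs_div, abs_of_pos (by linarith : 0 < amplitude q t)] at h4
      have h5 : F t = (|u t| / amplitude q t - c * g (θ t)) * (amplitude q t * e t) := by
        simp only [hF]
        field_simp
      rw [h5, abs_mul, abs_of_pos (by positivity : 0 < amplitude q t * e t)]
      calc _ ≤ (C₂ / κ ^ 5 * (1 + t ^ 2) ^ K * c) * (C₃ * (1 + t ^ 2) ^ K₃ * e t) := by
            gcongr
            exact hA3 t
        _ = _ := by ring
    · push Not at hsmall
      have h5 : |F t| ≤ c * amplitude q t * e t + |u t| * e t := by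
        rw [abs_le]
        have h6 : c * (amplitude q t * e t * g (θ t)) ≤ c * amplitude q t * e t := by
          calc _ = (amplitude q t * e t) * (c * g (θ t)) := by ring
            _ ≤ (amplitude q t * e t) * c := by gcongr; exact hgθ t
            _ = _ := by ring
        have h7 : 0 ≤ c * (amplitude q t * e t * g (θ t)) := by
          calc 0 ≤ (amplitude q t * e t) * (c * g (θ t)) :=
                mul_nonneg (by positivity) (hgθ0 t)
            _ = _ := by ring
        have h8 : 0 ≤ |u t| * e t := by positivity
        simp only [hF]
        constructor <;> linarith
      refine h5.trans (add_le_add ?_ ?_)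
      · calc c * amplitude q t * e t ≤ 1 * (c * (C₃ * (1 + t ^ 2) ^ K₃) * e t) := by
              rw [one_mul]
              gcongr
              exact hA3 t
          _ ≤ (C₂ / κ ^ 5 * (1 + t ^ 2) ^ K) * (c * (C₃ * (1 + t ^ 2) ^ K₃) * e t) := by
              gcongr
          _ = _ := by ring
      · calc |u t| * e t ≤ (C₂ / κ ^ 5 * (1 + t ^ 2) ^ K) * (|u t| * e t) :=
              le_mul_of_one_le_left (by positivity) hsmall.le
          _ = C₂ / κ ^ 5 * (|u t| * ((1 + t ^ 2) ^ K * e t)) := by ring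
          -- The square of `u` is used because its integral `√(2π)` does not depend on `d`.
          _ ≤ C₂ / κ ^ 5 * ((u t ^ 2 + ((1 + t ^ 2) ^ K * e t) ^ 2) / 2) := by
              gcongr
              nlinarith [sq_nonneg (|u t| - (1 + t ^ 2) ^ K * e t), sq_abs (u t)]
          _ = _ := by
              rw [← exp_quarter_mul_self]
              ring
  have hFi1 : Integrable fun t => |u t| * e t := integrable_abs_hermiteWave_mul_exp d
  have hFi2 : Integrable fun t => amplitude q t * e t * g (θ t) := by
    have := integrable_evalEval_mul_exp_mul amplitudePoly (b := 1 / 4) (by norm_num) hqI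
      (hg.comp hθc) fun t => hM _
    simp only [amplitudePoly_evalEval] at this
    exact this
  have hFint : ∫ t, F t = (∫ t, |u t| * e t) - c * ∫ t, amplitude q t * e t * g (θ t) := by
    rw [← integral_const_mul, ← integral_sub hFi1 (hFi2.const_mul c)]
  have hi2 : Integrable fun t => u t ^ 2 := integrable_hermiteWave_sq d
  have hi2B : Integrable fun t => u t ^ 2 + (1 + t ^ 2) ^ (2 * K) * Real.exp (-(1 / 2) * t ^ 2) :=
    hi2.add hiB
  have hFle : |∫ t, F t| ≤ C₂ / κ ^ 5 * (C₃ * c * JA + (√(2 * Real.pi) + JB) / 2) := by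
    refine abs_integral_le_integral_abs.trans ((integral_mono (hFi1.sub (hFi2.const_mul c)).abs
      (((hiA.const_mul (C₃ * c)).add (hi2B.div_const 2)).const_mul (C₂ / κ ^ 5))
      hpoint).trans (le_of_eq ?_))
    simp only [Pi.add_apply]
    rw [integral_const_mul, integral_add (hiA.const_mul _) (hi2B.div_const 2),
      integral_const_mul, integral_div, integral_add hi2 hiB, integral_hermiteWave_sq]
  have hsplit : (∫ t, |u t| * e t) - c * (4 / √Real.pi * (1 + q / 8))
      = (∫ t, F t) + c * ((∫ t, amplitude q t * e t * g (θ t)) - 4 / √Real.pi * (1 + q / 8)) := by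
    rw [hFint]
    ring
  rw [hsplit]
  refine (abs_add_le _ _).trans ((add_le_add hFle (?_ : _ ≤ c * (C₁ * q ^ 2))).trans ?_)
  · rw [abs_mul, abs_of_nonneg hc]
    gcongr
  · set S := √(2 * Real.pi)
    have hS : 0 ≤ S := Real.sqrt_nonneg _
    have hq2 : 0 ≤ c * q ^ 2 := by positivity
    have hk : 0 < 1 / κ ^ 5 := by positivity
    have e1 : C₂ / κ ^ 5 * (C₃ * c * JA + (S + JB) / 2)
        ≤ C₂ * (C₃ * JA + (S + JB) / 2) * ((1 + c) / κ ^ 5) := by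
      rw [show C₂ / κ ^ 5 * (C₃ * c * JA + (S + JB) / 2)
        = C₂ * (C₃ * JA * c + (S + JB) / 2 * 1) * (1 / κ ^ 5) by ring,
        show C₂ * (C₃ * JA + (S + JB) / 2) * ((1 + c) / κ ^ 5)
        = C₂ * (C₃ * JA * (1 + c) + (S + JB) / 2 * (1 + c)) * (1 / κ ^ 5) by ring]
      gcongr <;> linarith
    have e2 : 0 ≤ C₂ * (C₃ * JA + (S + JB) / 2) * (c * q ^ 2) := by positivity
    have e3 : 0 ≤ C₁ * ((1 + c) / κ ^ 5) := by positivity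
    calc _ ≤ C₂ * (C₃ * JA + (S + JB) / 2) * ((1 + c) / κ ^ 5) + c * (C₁ * q ^ 2) := by gcongr
      _ ≤ C₂ * (C₃ * JA + (S + JB) / 2) * ((1 + c) / κ ^ 5) + c * (C₁ * q ^ 2)
          + C₂ * (C₃ * JA + (S + JB) / 2) * (c * q ^ 2) + C₁ * ((1 + c) / κ ^ 5) := by linarith
      _ = _ := by ring

end HermiteWave

/-! ### Values at zero and Wallis' product. -/

section CentralValues

lemma hermiteFun_odd_zero (m : ℕ) : hermiteFun (2 * m + 1) 0 = 0 := by
  induction m with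
  | zero => simp [hermiteFun_one]
  | succ m ih =>
    rw [show 2 * (m + 1) + 1 = (2 * m + 1) + 2 by ring, hermiteFun_add_two, ih]
    ring

lemma hermiteFun_even_zero_succ (m : ℕ) :
    hermiteFun (2 * (m + 1)) 0 = -(2 * m + 1) * hermiteFun (2 * m) 0 := by
  rw [show 2 * (m + 1) = 2 * m + 2 by ring, hermiteFun_add_two]
  push_cast
  ring

/-- The square of the value at zero of the normalized Hermite polynomial of degree `2m`. -/
noncomputable def hermiteCentralSq (m : ℕ) : ℝ := hermiteFun (2 * m) 0 ^ 2 / (2 * m).factorial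

lemma hermiteCentralSq_zero : hermiteCentralSq 0 = 1 := by
  simp [hermiteCentralSq, hermiteFun_zero]

lemma hermiteCentralSq_succ (m : ℕ) :
    hermiteCentralSq (m + 1) = (2 * m + 1) / (2 * m + 2) * hermiteCentralSq m := by
  rw [hermiteCentralSq, hermiteCentralSq, hermiteFun_even_zero_succ,
    show 2 * (m + 1) = 2 * m + 1 + 1 by ring, Nat.factorial_succ, Nat.factorial_succ]
  have h : ((2 * m).factorial : ℝ) ≠ 0 := by positivity
  have h1 : (2 * (m : ℝ) + 1) ≠ 0 := by positivity
  have h2 : (2 * (m : ℝ) + 2) ≠ 0 := by positivity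
  push_cast
  rw [show (2 * (m : ℝ) + 1 + 1) = 2 * m + 2 by ring]
  field_simp

lemma hermiteCentralSq_pos (m : ℕ) : 0 < hermiteCentralSq m := by
  induction m with
  | zero => simp [hermiteCentralSq_zero]
  | succ m ih =>
    rw [hermiteCentralSq_succ]
    positivity

/-- The factor relating consecutive Wallis products is inverse to the one from
`hermiteCentralSq_succ`, so the product stays at its initial value. -/
lemma wallis_mul_hermiteCentralSq (m : ℕ) :
    Real.Wallis.W m * (hermiteCentralSq m ^ 2 * (2 * m + 1)) = 1 := by
  induction m with
  | zero => simp [hermiteCentralSq_zero, Real.Wallis.W]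
  | succ m ih =>
    refine Eq.trans ?_ ih
    rw [Real.Wallis.W_succ, hermiteCentralSq_succ]
    have h1 : (2 * (m : ℝ) + 1) ≠ 0 := by positivity
    have h2 : (2 * (m : ℝ) + 2) ≠ 0 := by positivity
    have h3 : (2 * (m : ℝ) + 3) ≠ 0 := by positivity
    push_cast
    rw [show 2 * ((m : ℝ) + 1) + 1 = 2 * m + 3 by ring]
    field_simp

lemma tendsto_hermiteCentralSq_sq_mul :
    Tendsto (fun m : ℕ => hermiteCentralSq m ^ 2 * ((m : ℝ) + 1 / 4)) atTop (𝓝 (1 / Real.pi)) := by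
  have h1 : Tendsto (fun m : ℕ => (1 : ℝ) / ((m : ℝ) + 1)) atTop (𝓝 0) :=
    tendsto_one_div_add_atTop_nhds_zero_nat
  have h2 := Real.Wallis.tendsto_W_nhds_pi_div_two.inv₀ (by positivity)
  have h3 : Tendsto (fun m : ℕ => 1 / 2 - 1 / 4 * (1 / (2 * (m : ℝ) + 1))) atTop (𝓝 (1 / 2)) := by
    have h4 : Tendsto (fun m : ℕ => (1 : ℝ) / (2 * (m : ℝ) + 1)) atTop (𝓝 0) := by
      refine squeeze_zero (fun m => by positivity) (fun m => ?_) h1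
      apply one_div_le_one_div_of_le (by positivity)
      linarith [(Nat.cast_nonneg m : (0 : ℝ) ≤ m)]
    have h5 := (h4.const_mul (1 / 4)).const_sub (1 / 2)
    rwa [mul_zero, sub_zero] at h5
  have h := h2.mul h3
  rw [show (Real.pi / 2)⁻¹ * (1 / 2) = 1 / Real.pi by field_simp] at h
  refine h.congr fun m => ?_
  have hW : Real.Wallis.W m ≠ 0 := (Real.Wallis.W_pos m).ne'
  have hw := wallis_mul_hermiteCentralSq m
  have h5 : (2 * (m : ℝ) + 1) ≠ 0 := by positivity
  field_simp
  linear_combination (-(8 * (m : ℝ) + 2)) * hw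

lemma hermiteCentralSq_le_one (m : ℕ) : hermiteCentralSq m ≤ 1 := by
  induction m with
  | zero => simp [hermiteCentralSq_zero]
  | succ m ih =>
    rw [hermiteCentralSq_succ]
    refine mul_le_one₀ ?_ (hermiteCentralSq_pos m).le ih
    rw [div_le_one (by positivity)]
    linarith

/-- The sequence increases to its limit. The shift 1/4 is what makes the approximation accurate to
second order: after clearing denominators, consecutive terms differ only through a constant 1/4. -/
lemma hermiteCentralSq_sq_mul_le (m : ℕ) :
    hermiteCentralSq m ^ 2 * ((m : ℝ) + 1 / 4) ≤ 1 / Real.pi := by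
  refine (monotone_nat_of_le_succ fun m => ?_).ge_of_tendsto tendsto_hermiteCentralSq_sq_mul m
  rw [hermiteCentralSq_succ, mul_pow, mul_comm (_ ^ 2) (_ ^ 2), mul_assoc]
  gcongr
  push_cast
  rw [div_pow, div_mul_eq_mul_div, le_div_iff₀ (by positivity)]
  nlinarith [(Nat.cast_nonneg m : (0 : ℝ) ≤ m)]

/-- The added correction of order `1/m` makes the sequence decrease to the same limit, so that the
two monotone sequences enclose `1/π`. -/
lemma le_hermiteCentralSq_sq_mul (m : ℕ) :
    1 / Real.pi ≤ hermiteCentralSq m ^ 2 * ((m : ℝ) + 1 / 4 + 1 / 4 * (1 / ((m : ℝ) + 1))) := by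
  have hlim : Tendsto (fun m : ℕ => hermiteCentralSq m ^ 2
      * ((m : ℝ) + 1 / 4 + 1 / 4 * (1 / ((m : ℝ) + 1)))) atTop (𝓝 (1 / Real.pi)) := by
    have h1 : Tendsto (fun m : ℕ => hermiteCentralSq m ^ 2 * (1 / 4 * (1 / ((m : ℝ) + 1)))) atTop
        (𝓝 0) := by
      refine squeeze_zero (fun m => by positivity) (fun m => ?_)
        (tendsto_one_div_add_atTop_nhds_zero_nat (𝕜 := ℝ))
      have h2 : hermiteCentralSq m ^ 2 ≤ 1 :=
        pow_le_one₀ (hermiteCentralSq_pos m).le (hermiteCentralSq_le_one m)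
      have h3 : (0 : ℝ) ≤ 1 / ((m : ℝ) + 1) := by positivity
      nlinarith
    have h := tendsto_hermiteCentralSq_sq_mul.add h1
    rw [add_zero] at h
    exact h.congr fun m => by ring
  refine (antitone_nat_of_succ_le fun m => ?_).le_of_tendsto hlim m
  rw [hermiteCentralSq_succ, mul_pow, mul_comm (_ ^ 2) (_ ^ 2), mul_assoc]
  gcongr
  push_cast
  have hm : (0 : ℝ) ≤ m := Nat.cast_nonneg m
  have e : ((m : ℝ) + 1 / 4 + 1 / 4 * (1 / ((m : ℝ) + 1)))
      - ((2 * (m : ℝ) + 1) / (2 * m + 2)) ^ 2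
        * ((m : ℝ) + 1 + 1 / 4 + 1 / 4 * (1 / ((m : ℝ) + 1 + 1)))
      = (7 * m + 5) / (16 * (m + 1) ^ 2 * (m + 2)) := by
    have h1 : (m : ℝ) + 1 ≠ 0 := by positivity
    have h2 : (m : ℝ) + 2 ≠ 0 := by positivity
    rw [show (m : ℝ) + 1 + 1 = m + 2 by ring, show 2 * (m : ℝ) + 2 = 2 * (m + 1) by ring]
    field_simp
    ring
  have e2 : (0 : ℝ) ≤ (7 * m + 5) / (16 * (m + 1) ^ 2 * (m + 2)) := by positivity
  linarith

lemma abs_hermiteCentralSq_sub_one_le (m : ℕ) :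
    |hermiteCentralSq m ^ 2 * Real.pi * ((m : ℝ) + 1 / 4) - 1| ≤ 1 / ((m : ℝ) + 1) ^ 2 := by
  have h1 := hermiteCentralSq_sq_mul_le m
  have h2 := le_hermiteCentralSq_sq_mul m
  have hm : (0 : ℝ) ≤ m := Nat.cast_nonneg m
  rw [le_div_iff₀ Real.pi_pos] at h1
  rw [div_le_iff₀ Real.pi_pos] at h2
  set s := hermiteCentralSq m ^ 2 * Real.pi with hs
  have hs0 : 0 ≤ s := by positivity
  have h1' : s * ((m : ℝ) + 1 / 4) ≤ 1 := by rw [hs]; linarith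
  have h2' : 1 ≤ s * ((m : ℝ) + 1 / 4) + s * (1 / 4 * (1 / ((m : ℝ) + 1))) := by
    rw [hs]; linarith
  have h3 : s * (1 / 4) ≤ 1 / ((m : ℝ) + 1) := by
    rw [le_div_iff₀ (by positivity)]
    nlinarith
  have h4 : s * (1 / 4 * (1 / ((m : ℝ) + 1))) ≤ 1 / ((m : ℝ) + 1) ^ 2 := by
    calc s * (1 / 4 * (1 / ((m : ℝ) + 1))) = s * (1 / 4) * (1 / ((m : ℝ) + 1)) := by ring
      _ ≤ 1 / ((m : ℝ) + 1) * (1 / ((m : ℝ) + 1)) := by gcongr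
      _ = _ := by rw [pow_two]; field_simp
  rw [abs_le]
  constructor <;> linarith [(by positivity : (0 : ℝ) ≤ 1 / ((m : ℝ) + 1) ^ 2)]

end CentralValues

/-! ### Sequences of the form `1 + O(1/d²)`. -/

section QuadraticallyNearOne

/-- A sequence which is `1 + O(1/d²)`. -/
def QuadraticallyNearOne (f : ℕ → ℝ) : Prop :=
  ∃ C : ℝ, 0 ≤ C ∧ ∀ d : ℕ, 1 ≤ d → |f d - 1| ≤ C / (d : ℝ) ^ 2

namespace QuadraticallyNearOne

lemma mul {f g : ℕ → ℝ} (hf : QuadraticallyNearOne f) (hg : QuadraticallyNearOne g) :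
    QuadraticallyNearOne fun d => f d * g d := by
  obtain ⟨C, hC, hf⟩ := hf
  obtain ⟨C', hC', hg⟩ := hg
  refine ⟨C * C' + C + C', by positivity, fun d hd => ?_⟩
  have hd' : (1 : ℝ) ≤ (d : ℝ) ^ 2 := one_le_pow₀ (by exact_mod_cast hd)
  have h1 := hf d hd
  have h2 := hg d hd
  have h3 : C' / (d : ℝ) ^ 2 ≤ C' := div_le_self hC' hd'
  calc |f d * g d - 1| = |(f d - 1) * (g d - 1) + (f d - 1) + (g d - 1)| := by ring_nf
    _ ≤ |f d - 1| * |g d - 1| + |f d - 1| + |g d - 1| := by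
        rw [← abs_mul]
        exact (abs_add_le _ _).trans (add_le_add (abs_add_le _ _) le_rfl)
    _ ≤ C / (d : ℝ) ^ 2 * C' + C / (d : ℝ) ^ 2 + C' / (d : ℝ) ^ 2 := by
        gcongr
        exact h2.trans h3
    _ = _ := by ring

lemma pow {f : ℕ → ℝ} (hf : QuadraticallyNearOne f) (n : ℕ) :
    QuadraticallyNearOne fun d => f d ^ n := by
  induction n with
  | zero => exact ⟨0, le_rfl, fun d _ => by simp⟩
  | succ n ih =>
    simp_rw [pow_succ]
    exact ih.mul hf

/-- In `f⁴ - 1 = (f - 1)(f + 1)(f² + 1)` the last two factors have product at least 1. Fractional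
powers can therefore be handled through their fourth powers. -/
lemma of_pow_four {f : ℕ → ℝ} (h0 : ∀ d, 0 ≤ f d)
    (hf : QuadraticallyNearOne fun d => f d ^ 4) : QuadraticallyNearOne f := by
  obtain ⟨C, hC, hf⟩ := hf
  refine ⟨C, hC, fun d hd => le_trans ?_ (hf d hd)⟩
  have h1 : f d ^ 4 - 1 = (f d - 1) * ((f d + 1) * (f d ^ 2 + 1)) := by ring
  have h2 : 1 ≤ (f d + 1) * (f d ^ 2 + 1) := by
    have := h0 d
    nlinarith [pow_nonneg this 3, pow_nonneg this 2]
  rw [h1, abs_mul, abs_of_nonneg (by linarith : 0 ≤ (f d + 1) * (f d ^ 2 + 1))]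
  exact le_mul_of_one_le_right (abs_nonneg _) h2

lemma of_even_odd {f g h : ℕ → ℝ} (hg : QuadraticallyNearOne g) (hh : QuadraticallyNearOne h)
    (he : ∀ m, f (2 * m) = g (2 * m)) (ho : ∀ m, f (2 * m + 1) = h (2 * m + 1)) :
    QuadraticallyNearOne f := by
  obtain ⟨C, hC, hg⟩ := hg
  obtain ⟨C', hC', hh⟩ := hh
  refine ⟨C + C', by positivity, fun d hd => ?_⟩
  have h1 : (0 : ℝ) ≤ C / (d : ℝ) ^ 2 := by positivity
  have h2 : (0 : ℝ) ≤ C' / (d : ℝ) ^ 2 := by positivity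
  rw [add_div]
  rcases Nat.even_or_odd' d with ⟨m, rfl | rfl⟩
  · rw [he]
    linarith [hg _ hd]
  · rw [ho]
    linarith [hh _ hd]

lemma hermiteCentralSq_half : QuadraticallyNearOne fun d =>
    hermiteCentralSq (d / 2) ^ 2 * Real.pi * (((d / 2 : ℕ) : ℝ) + 1 / 4) := by
  refine ⟨4, by norm_num, fun d hd => (abs_hermiteCentralSq_sub_one_le (d / 2)).trans ?_⟩
  have hd' : (0 : ℝ) < d := by exact_mod_cast hd
  rw [div_le_div_iff₀ (by positivity) (by positivity)]
  have h : (d : ℝ) ≤ 2 * (((d / 2 : ℕ) : ℝ) + 1) := by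
    have : d ≤ 2 * (d / 2 + 1) := by omega
    exact_mod_cast this
  nlinarith

lemma sq_div_sq_sub : QuadraticallyNearOne fun d : ℕ => (d : ℝ) ^ 2 / ((d : ℝ) ^ 2 - 1 / 4) := by
  refine ⟨1, zero_le_one, fun d hd => ?_⟩
  have hd' : (1 : ℝ) ≤ (d : ℝ) ^ 2 := one_le_pow₀ (by exact_mod_cast hd)
  have h1 : (0 : ℝ) < (d : ℝ) ^ 2 - 1 / 4 := by linarith
  have h2 : (d : ℝ) ^ 2 / ((d : ℝ) ^ 2 - 1 / 4) - 1 = 1 / 4 / ((d : ℝ) ^ 2 - 1 / 4) := by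
    rw [div_sub_one h1.ne']
    congr 1
    ring
  rw [h2, abs_of_nonneg (by positivity), div_le_div_iff₀ h1 (by positivity)]
  linarith

lemma amplitude_zero : QuadraticallyNearOne fun d : ℕ => amplitude (1 / ((d : ℝ) + 1 / 2)) 0 := by
  refine ⟨1, zero_le_one, fun d hd => ?_⟩
  have hd' : (0 : ℝ) < d := by exact_mod_cast hd
  have h1 : amplitude (1 / ((d : ℝ) + 1 / 2)) 0 - 1 = -(1 / 32 / ((d : ℝ) + 1 / 2) ^ 2) := by
    rw [amplitude]
    generalize (d : ℝ) + 1 / 2 = s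
    ring
  rw [h1, abs_neg, abs_of_nonneg (by positivity), div_le_div_iff₀ (by positivity) (by positivity)]
  nlinarith

lemma amplitude_zero_inv :
    QuadraticallyNearOne fun d : ℕ => (amplitude (1 / ((d : ℝ) + 1 / 2)) 0)⁻¹ := by
  obtain ⟨C, hC, h⟩ := amplitude_zero
  refine ⟨2 * C, by positivity, fun d hd => ?_⟩
  have hd' : (1 : ℝ) ≤ d := by exact_mod_cast hd
  have hA : 1 / 2 ≤ amplitude (1 / ((d : ℝ) + 1 / 2)) 0 := by
    refine half_le_amplitude ⟨by positivity, ?_⟩ 0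
    rw [div_le_one (by positivity)]
    linarith
  have h1 := h d hd
  set A := amplitude (1 / ((d : ℝ) + 1 / 2)) 0
  have hA0 : 0 < A := by linarith
  have h2 : A⁻¹ - 1 = -(A - 1) * A⁻¹ := by
    field_simp
    ring
  have h3 : A⁻¹ ≤ 2 := by
    rw [inv_le_comm₀ hA0 (by norm_num)]
    linarith
  rw [h2, abs_mul, abs_neg, abs_of_pos (inv_pos.2 hA0)]
  calc |A - 1| * A⁻¹ ≤ C / (d : ℝ) ^ 2 * 2 := by gcongr
    _ = _ := by ring

/-- With `x = q/8` the quantity is `(1 - 4x)(1 + x)⁴`, whose linear term vanishes. This cancellation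
is why the final error has order `1/d²` and not `1/d`. -/
lemma frequency_correction : QuadraticallyNearOne fun d : ℕ =>
    (d : ℝ) / ((d : ℝ) + 1 / 2) * (1 + 1 / ((d : ℝ) + 1 / 2) / 8) ^ 4 := by
  refine ⟨1, zero_le_one, fun d hd => ?_⟩
  have hd' : (1 : ℝ) ≤ d := by exact_mod_cast hd
  set x : ℝ := 1 / (8 * ((d : ℝ) + 1 / 2)) with hx
  have hx0 : 0 ≤ x := by positivity
  have hx1 : x ≤ 1 / 8 * (1 / d) := by
    rw [hx, ← one_div_mul_one_div]
    gcongr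
    linarith
  have hx2 : x ≤ 1 / 8 := by
    rw [hx]
    apply one_div_le_one_div_of_le (by norm_num)
    linarith
  have h1 : (d : ℝ) / ((d : ℝ) + 1 / 2) = 1 - 4 * x := by
    rw [hx]
    field_simp
    ring
  have h2 : 1 / ((d : ℝ) + 1 / 2) / 8 = x := by
    rw [hx]
    field_simp
  have h3 : (1 - 4 * x) * (1 + x) ^ 4 - 1
      = -(x ^ 2 * (10 + 20 * x + 15 * x ^ 2 + 4 * x ^ 3)) := by ring
  have h4 : 10 + 20 * x + 15 * x ^ 2 + 4 * x ^ 3 ≤ 49 := by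
    have : x ^ 2 ≤ 1 := pow_le_one₀ hx0 (by linarith)
    have : x ^ 3 ≤ 1 := pow_le_one₀ hx0 (by linarith)
    linarith
  simp only [h1, h2, h3, abs_neg]
  rw [abs_of_nonneg (by positivity)]
  calc x ^ 2 * (10 + 20 * x + 15 * x ^ 2 + 4 * x ^ 3) ≤ (1 / 8 * (1 / d)) ^ 2 * 49 := by gcongr
    _ ≤ 1 / (d : ℝ) ^ 2 := by
        rw [mul_pow, one_div_pow (d : ℝ)]
        have : (0 : ℝ) ≤ 1 / (d : ℝ) ^ 2 := by positivity
        linarith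

end QuadraticallyNearOne

end QuadraticallyNearOne

/-! ### Asymptotics of the Hermite integral. -/

section HermiteAsymptotics

/-- The amplitude of the oscillatory approximation of `hermiteWave d`. -/
noncomputable def hermiteWaveAmplitude (d : ℕ) : ℝ :=
  |hermiteWave d 0 / amplitude (1 / ((d : ℝ) + 1 / 2)) 0|
    + |hermiteWaveDeriv d 0 * amplitude (1 / ((d : ℝ) + 1 / 2)) 0 / √((d : ℝ) + 1 / 2)|

lemma hermiteWaveAmplitude_nonneg (d : ℕ) : 0 ≤ hermiteWaveAmplitude d := by
  unfold hermiteWaveAmplitude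
  positivity

lemma hermiteWaveDeriv_even_zero (m : ℕ) : hermiteWaveDeriv (2 * m) 0 = 0 := by
  simp [hermiteWaveDeriv, hermiteFun_odd_zero]

lemma hermiteWave_odd_zero (m : ℕ) : hermiteWave (2 * m + 1) 0 = 0 := by
  simp [hermiteWave, hermiteFun_odd_zero]

lemma hermiteWave_even_zero_sq (m : ℕ) : hermiteWave (2 * m) 0 ^ 2 = hermiteCentralSq m := by
  rw [hermiteWave_sq, hermiteCentralSq]
  simp [pow_two]

lemma hermiteWaveDeriv_odd_zero_sq (m : ℕ) :
    hermiteWaveDeriv (2 * m + 1) 0 ^ 2 = (2 * m + 1) * hermiteCentralSq m := by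
  have h : hermiteFun (2 * m + 1 + 1) 0 = -(2 * m + 1) * hermiteFun (2 * m) 0 :=
    hermiteFun_even_zero_succ m
  rw [hermiteWaveDeriv, hermiteCentralSq, h, div_pow, Real.sq_sqrt (by positivity),
    Nat.factorial_succ]
  have h1 : ((2 * m).factorial : ℝ) ≠ 0 := by positivity
  have h2 : (2 * (m : ℝ) + 1) ≠ 0 := by positivity
  push_cast
  simp only [ne_eq, OfNat.ofNat_ne_zero, not_false_eq_true, zero_pow, mul_zero, Real.exp_zero]
  field_simp
  ring

/-- Only the value at zero contributes for even `d`, only the derivative for odd `d`. For `d = 2m`,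
`d + 1/2 = 2(m + 1/4)` matches the shift in the Wallis estimate; for `d = 2m + 1` the match is `d -
1/2 = 2(m + 1/4)`, leaving the factor `d²/(d² - 1/4)`. -/
lemma quadraticallyNearOne_hermiteWaveAmplitude : QuadraticallyNearOne fun d =>
    hermiteWaveAmplitude d ^ 4 * ((d : ℝ) + 1 / 2) * (Real.pi / 2) := by
  refine QuadraticallyNearOne.of_even_odd
    (QuadraticallyNearOne.hermiteCentralSq_half.mul (QuadraticallyNearOne.amplitude_zero_inv.pow 4))
    ((QuadraticallyNearOne.hermiteCentralSq_half.mul QuadraticallyNearOne.sq_div_sq_sub).mul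
      (QuadraticallyNearOne.amplitude_zero.pow 4)) (fun m => ?_) fun m => ?_
  · have h4 : hermiteWaveAmplitude (2 * m) ^ 4
        = hermiteCentralSq m ^ 2 * (amplitude (1 / (((2 * m : ℕ) : ℝ) + 1 / 2)) 0)⁻¹ ^ 4 := by
      rw [hermiteWaveAmplitude, hermiteWaveDeriv_even_zero, zero_mul, zero_div, abs_zero, add_zero,
        ← hermiteWave_even_zero_sq, Even.pow_abs (by decide), div_eq_mul_inv, mul_pow]
      ring
    rw [h4, show 2 * m / 2 = m by omega]
    push_cast
    ring
  · have h4 : hermiteWaveAmplitude (2 * m + 1) ^ 4 = ((2 * m + 1) * hermiteCentralSq m) ^ 2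
        * amplitude (1 / (((2 * m + 1 : ℕ) : ℝ) + 1 / 2)) 0 ^ 4
          / (((2 * m + 1 : ℕ) : ℝ) + 1 / 2) ^ 2 := by
      rw [hermiteWaveAmplitude, hermiteWave_odd_zero, zero_div, abs_zero, zero_add,
        ← hermiteWaveDeriv_odd_zero_sq, Even.pow_abs (by decide), div_pow, mul_pow,
        show √(((2 * m + 1 : ℕ) : ℝ) + 1 / 2) ^ 4 = (√(((2 * m + 1 : ℕ) : ℝ) + 1 / 2) ^ 2) ^ 2 by ring,
        Real.sq_sqrt (by positivity)]
      ring
    rw [h4, show (2 * m + 1) / 2 = m by omega]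
    generalize amplitude (1 / (((2 * m + 1 : ℕ) : ℝ) + 1 / 2)) 0 = A
    push_cast
    have h1 : (2 * (m : ℝ) + 1 + 1 / 2) ≠ 0 := by positivity
    have h2 : (2 * (m : ℝ) + 1) ^ 2 - 1 / 4 = (2 * (m : ℝ) + 1 + 1 / 2) * (2 * (m + 1 / 4)) := by ring
    have h3 : (m : ℝ) + 1 / 4 ≠ 0 := by positivity
    rw [h2]
    generalize (m : ℝ) + 1 / 4 = s at *
    generalize 2 * (m : ℝ) + 1 + 1 / 2 = r at *
    field_simp

/-- By parity the approximation is a pure cosine for even `d` and a pure sine for odd `d`; the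
moduli of both have mean `2/π` over a period. -/
theorem exists_abs_integral_hermiteWave_sub_amplitude_le :
    ∃ C : ℝ, 0 ≤ C ∧ ∀ d : ℕ, 1 ≤ d →
      |(∫ t, |hermiteWave d t| * Real.exp (-(1 / 4) * t ^ 2))
          - hermiteWaveAmplitude d * (4 / √Real.pi * (1 + 1 / ((d : ℝ) + 1 / 2) / 8))|
        ≤ C * (hermiteWaveAmplitude d * (1 / ((d : ℝ) + 1 / 2)) ^ 2
          + (1 + hermiteWaveAmplitude d) / √((d : ℝ) + 1 / 2) ^ 5) := by
  obtain ⟨C, hC, h⟩ := exists_abs_integral_hermiteWave_sub_le Real.continuous_cos.abs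
    (fun s => by rw [Real.cos_add_pi, abs_neg]) integral_abs_cos_sub
  obtain ⟨C', hC', h'⟩ := exists_abs_integral_hermiteWave_sub_le Real.continuous_sin.abs
    (fun s => by rw [Real.sin_add_pi, abs_neg]) integral_abs_sin_sub
  refine ⟨C + C', by positivity, fun d hd => ?_⟩
  have hnn := hermiteWaveAmplitude_nonneg d
  have hκ : 0 < √((d : ℝ) + 1 / 2) := by positivity
  have hκ2 : √((d : ℝ) + 1 / 2) ^ 2 = (d : ℝ) + 1 / 2 := Real.sq_sqrt (by positivity)
  have hpos : 0 ≤ hermiteWaveAmplitude d * (1 / ((d : ℝ) + 1 / 2)) ^ 2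
      + (1 + hermiteWaveAmplitude d) / √((d : ℝ) + 1 / 2) ^ 5 := by positivity
  rw [add_mul]
  rcases Nat.even_or_odd' d with ⟨m, rfl | rfl⟩
  · refine (h (2 * m) hd _ _ _ rfl hκ hκ2 hnn (fun s => ?_) rfl).trans
      (le_add_of_nonneg_right (mul_nonneg hC' hpos))
    simp [hermiteWaveAmplitude, hermiteWaveDeriv_even_zero, abs_mul]
  · refine (h' (2 * m + 1) hd _ _ _ rfl hκ hκ2 hnn (fun s => ?_) rfl).trans
      (le_add_of_nonneg_left (mul_nonneg hC hpos))
    rw [hermiteWaveAmplitude, hermiteWave_odd_zero]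
    simp [abs_mul]

/-- The ratio of `hermiteIntegral d` and its asymptotic value is `1 + O(1/d²)`. -/
theorem quadraticallyNearOne_hermiteIntegral : QuadraticallyNearOne fun d =>
    hermiteIntegral d / ((2 : ℝ) ^ (7 / 4 : ℝ) / Real.pi ^ (5 / 4 : ℝ)
      * (1 / (d : ℝ) ^ (1 / 4 : ℝ))) := by
  -- In terms of the fourth roots of `π` and 2, all constants become monomials.
  set p : ℝ := Real.pi ^ (1 / 4 : ℝ) with hp
  set s : ℝ := (2 : ℝ) ^ (1 / 4 : ℝ) with hs
  have hp0 : 0 < p := Real.rpow_pos_of_pos Real.pi_pos _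
  have hs0 : 0 < s := Real.rpow_pos_of_pos two_pos _
  have hp4 : p ^ 4 = Real.pi := by
    rw [hp, ← Real.rpow_natCast, ← Real.rpow_mul Real.pi_pos.le]
    norm_num
  have hs4 : s ^ 4 = 2 := by
    rw [hs, ← Real.rpow_natCast, ← Real.rpow_mul two_pos.le]
    norm_num
  have hp5 : Real.pi ^ (5 / 4 : ℝ) = p ^ 5 := by
    rw [hp, ← Real.rpow_natCast, ← Real.rpow_mul Real.pi_pos.le]
    norm_num
  have hs7 : (2 : ℝ) ^ (7 / 4 : ℝ) = s ^ 7 := by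
    rw [hs, ← Real.rpow_natCast, ← Real.rpow_mul two_pos.le]
    norm_num
  have hsqrtpi : √Real.pi = p ^ 2 := by
    rw [Real.sqrt_eq_iff_mul_self_eq Real.pi_pos.le (by positivity), ← hp4]
    ring
  have hsqrt2 : √(2 * Real.pi) = s ^ 2 * p ^ 2 := by
    rw [Real.sqrt_eq_iff_mul_self_eq (by positivity) (by positivity), ← hp4, ← hs4]
    ring
  have hr4 : ∀ d : ℕ, ((d : ℝ) ^ (1 / 4 : ℝ)) ^ 4 = d := fun d => by
    rw [← Real.rpow_natCast, ← Real.rpow_mul (Nat.cast_nonneg d)]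
    norm_num
  -- The main term divided by the claimed asymptotic value. Its fourth power is the product of the
  -- amplitude estimate and the frequency correction.
  have hF : QuadraticallyNearOne fun d => hermiteWaveAmplitude d * (d : ℝ) ^ (1 / 4 : ℝ)
      * (p / s) * (1 + 1 / ((d : ℝ) + 1 / 2) / 8) := by
    refine QuadraticallyNearOne.of_pow_four (fun d => ?_) ?_
    · have := hermiteWaveAmplitude_nonneg d
      positivity
    · have h := quadraticallyNearOne_hermiteWaveAmplitude.mul
        QuadraticallyNearOne.frequency_correction
      convert h using 2 with d
      rw [mul_pow, mul_pow, mul_pow, hr4, div_pow, hp4, hs4]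
      have h1 : (d : ℝ) + 1 / 2 ≠ 0 := by positivity
      generalize 1 + 1 / ((d : ℝ) + 1 / 2) / 8 = w
      field_simp
  obtain ⟨C, hC, hF⟩ := hF
  obtain ⟨C', hC', hI⟩ := exists_abs_integral_hermiteWave_sub_amplitude_le
  refine ⟨C + p ^ 3 / s ^ 9 * (C' * (2 * ((1 + C) * (s / p)) + 1)), by positivity, fun d hd => ?_⟩
  have hd' : (1 : ℝ) ≤ d := by exact_mod_cast hd
  have hr0 : 0 < (d : ℝ) ^ (1 / 4 : ℝ) := Real.rpow_pos_of_pos (by linarith) _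
  have hr4 := hr4 d
  have hFd := hF d hd
  have hId := hI d hd
  beta_reduce at hFd ⊢
  rw [hermiteIntegral_eq_hermiteWave, hs7, hp5, hsqrt2]
  rw [hsqrtpi] at hId
  set r : ℝ := (d : ℝ) ^ (1 / 4 : ℝ)
  set c := hermiteWaveAmplitude d
  have hc : 0 ≤ c := hermiteWaveAmplitude_nonneg d
  set w := 1 + 1 / ((d : ℝ) + 1 / 2) / 8 with hw
  have hw1 : 1 ≤ w := le_add_of_nonneg_right (by positivity)
  set J := ∫ t, |hermiteWave d t| * Real.exp (-(1 / 4) * t ^ 2)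
  set κ := √((d : ℝ) + 1 / 2) with hκdef
  have hκ2 : κ ^ 2 = (d : ℝ) + 1 / 2 := Real.sq_sqrt (by positivity)
  have hκ0 : 0 < κ := by positivity
  have hcr : c * r ≤ (1 + C) * (s / p) := by
    have h1 : c * r * (p / s) * w ≤ 1 + C := by
      have h2 : C / (d : ℝ) ^ 2 ≤ C := div_le_self hC (one_le_pow₀ hd')
      linarith [(abs_le.1 hFd).2]
    have h3 : c * r * (p / s) ≤ 1 + C := (le_mul_of_one_le_right (by positivity) hw1).trans h1
    calc c * r = c * r * (p / s) * (s / p) := by field_simp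
      _ ≤ _ := by gcongr
  -- Division by the asymptotic value multiplies the error by a multiple of `r = d^(1/4)`. Since `r
  -- ≤ κ` and `c r` is bounded, the error `κ⁻⁵` still becomes `O(κ⁻⁴) = O(1/d²)`.
  have hrk : r ≤ κ := by
    refine le_of_pow_le_pow_left₀ two_ne_zero hκ0.le ?_
    refine le_of_pow_le_pow_left₀ two_ne_zero (by positivity) ?_
    rw [hκ2, ← pow_mul, hr4]
    nlinarith
  have hk4 : 1 / κ ^ 4 ≤ 1 / (d : ℝ) ^ 2 := by
    rw [show κ ^ 4 = (κ ^ 2) ^ 2 by ring, hκ2]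
    gcongr
    linarith
  have hκ1 : 1 ≤ κ := by
    refine le_of_pow_le_pow_left₀ two_ne_zero hκ0.le ?_
    rw [hκ2]
    linarith
  have herr : r * (c * (1 / ((d : ℝ) + 1 / 2)) ^ 2 + (1 + c) / κ ^ 5)
      ≤ (2 * ((1 + C) * (s / p)) + 1) * (1 / (d : ℝ) ^ 2) := by
    have e1 : (1 / ((d : ℝ) + 1 / 2)) ^ 2 = 1 / κ ^ 4 := by
      rw [← hκ2]
      field_simp
    have e2 : (1 : ℝ) / κ ^ 5 ≤ 1 / κ ^ 4 := by
      gcongr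
      norm_num
    have e3 : r * (1 / κ ^ 5) ≤ 1 / κ ^ 4 := by
      calc r * (1 / κ ^ 5) ≤ κ * (1 / κ ^ 5) := by gcongr
        _ = _ := by field_simp
    calc r * (c * (1 / ((d : ℝ) + 1 / 2)) ^ 2 + (1 + c) / κ ^ 5)
        = c * r * (1 / κ ^ 4) + c * r * (1 / κ ^ 5) + r * (1 / κ ^ 5) := by
          rw [e1]
          ring
      _ ≤ (1 + C) * (s / p) * (1 / κ ^ 4) + (1 + C) * (s / p) * (1 / κ ^ 4) + 1 / κ ^ 4 := by
          gcongr
      _ = (2 * ((1 + C) * (s / p)) + 1) * (1 / κ ^ 4) := by ring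
      _ ≤ _ := by gcongr
  have hsplit : 1 / (s ^ 2 * p ^ 2) * J / (s ^ 7 / p ^ 5 * (1 / r)) - 1
      = (c * r * (p / s) * w - 1) + p ^ 3 / s ^ 9 * (r * (J - c * (4 / p ^ 2 * w))) := by
    have h4 : (4 : ℝ) = s ^ 8 := by
      rw [show s ^ 8 = (s ^ 4) ^ 2 by ring, hs4]
      norm_num
    rw [h4]
    field_simp
    ring
  rw [hsplit]
  refine (abs_add_le _ _).trans ?_
  rw [abs_mul (p ^ 3 / s ^ 9), abs_mul r, abs_of_pos hr0,
    abs_of_pos (by positivity : 0 < p ^ 3 / s ^ 9)]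
  calc _ ≤ C / (d : ℝ) ^ 2 + p ^ 3 / s ^ 9 * (r * (C' * (c * (1 / ((d : ℝ) + 1 / 2)) ^ 2
        + (1 + c) / κ ^ 5))) := by gcongr
    _ = C / (d : ℝ) ^ 2 + p ^ 3 / s ^ 9 * (C' * (r * (c * (1 / ((d : ℝ) + 1 / 2)) ^ 2
        + (1 + c) / κ ^ 5))) := by ring
    _ ≤ C / (d : ℝ) ^ 2 + p ^ 3 / s ^ 9 * (C' * ((2 * ((1 + C) * (s / p)) + 1)
        * (1 / (d : ℝ) ^ 2))) := by gcongr
    _ = _ := by ring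

end HermiteAsymptotics

theorem mainTheorem9 :
    (∀ d : ℕ, 1 ≤ d →
      Integrable (hermiteIntegrand d) ∧
      (∀ N : ℕ, projectionConstant (BooleanSpace N {S | S.card = d}) ≠ ⊤ ∧
        projectionConstant (BooleanSpace N {S | S.card ≤ d}) ≠ ⊤) ∧
      Tendsto (fun N : ℕ =>
          (projectionConstant (BooleanSpace N {S | S.card = d})).toReal /
            √(Module.finrank ℝ (BooleanSpace N {S | S.card = d}) : ℝ))
        atTop (𝓝 (hermiteIntegral d)) ∧
      Tendsto (fun N : ℕ =>
          (projectionConstant (BooleanSpace N {S | S.card ≤ d})).toReal /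
            √(Module.finrank ℝ (BooleanSpace N {S | S.card ≤ d}) : ℝ))
        atTop (𝓝 (hermiteIntegral d))) ∧
    ∃ ε : ℕ → ℝ, (ε =O[atTop] fun d : ℕ => 1 / (d : ℝ) ^ 2) ∧
      ∀ d : ℕ, 1 ≤ d →
        hermiteIntegral d =
          (2 : ℝ) ^ (7 / 4 : ℝ) / Real.pi ^ (5 / 4 : ℝ) * (1 / (d : ℝ) ^ (1 / 4 : ℝ)) *
            (1 + ε d) := by
  refine ⟨fun d _ => ⟨integrable_hermiteIntegrand d, fun N => projectionConstant_ne_top N d,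
    tendsto_projectionConstant_card_eq d, tendsto_projectionConstant_card_le d⟩, ?_⟩
  obtain ⟨C, hC, h⟩ := quadraticallyNearOne_hermiteIntegral
  refine ⟨fun d => hermiteIntegral d / ((2 : ℝ) ^ (7 / 4 : ℝ) / Real.pi ^ (5 / 4 : ℝ)
    * (1 / (d : ℝ) ^ (1 / 4 : ℝ))) - 1, ?_, fun d hd => ?_⟩
  · refine IsBigO.of_bound C ?_
    filter_upwards [eventually_ge_atTop 1] with d hd
    rw [Real.norm_eq_abs, Real.norm_eq_abs, abs_of_nonneg (by positivity : 0 ≤ 1 / (d : ℝ) ^ 2)]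
    exact (h d hd).trans_eq (by ring)
  · have hd' : (0 : ℝ) < d := by exact_mod_cast hd
    rw [add_sub_cancel, mul_div_cancel₀]
    have h1 := Real.rpow_pos_of_pos hd' (1 / 4)
    have h2 := Real.rpow_pos_of_pos Real.pi_pos (5 / 4)
    positivity
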